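/- Let $k\ge 2$. A nondeterministic two-way $k$-head finite automaton consists of a finite set $S$ of states, a finite input alphabet $A$, two endmarkers $\vartriangleright,\vartriangleleft\notin A$, an initial state $s_0\in S$, a set $F\subseteq S$ of accepting states, and a partial transition function $\delta$ from $S\times(A\cup\{\vartriangleright,\vartriangleleft\})^k$ to subsets of $S\times\{-1,0,1\}^k$ such that a head scanning $\vartriangleright$ is never moved by $-1$ and a head scanning $\vartriangleleft$ is never moved by $1$. On input $w\in A^*$ its $k$ read-only heads work on the tape $\vartriangleright w\vartriangleleft$, starting in state $s_0$ with all heads on square $1$, where $\vartriangleright$ occupies square $0$; in one step, if $(s',(d_1,\dots,d_k))\in\delta(s,(a_1,\dots,a_k))$, where $s$ is the current state and $a_i$ is the symbol scanned by head $i$, the automaton may enter state $s'$ and move head $i$ by $d_i$ squares for every $i$. It halts where $\delta$ is undefined (equivalently, gives no successor). The accepted language $L(M)$ is the set of all $w\in A^*$ on which some computation halts in an accepting state. The automaton is deterministic if $\delta$ is everywhere undefined or a singleton, and one-way if no transition moves a head by $-1$. Fix one of the four types: deterministic one-way, nondeterministic one-way, deterministic two-way, or nondeterministic two-way $k$-head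 finite automata. (Nondeterministic and two-way mean that the corresponding restriction is not imposed.) Automata are given by finite descriptions: number of states, size of the alphabet, initial state, list of accepting states, and list of transitions. Then none of the following problems is semi-decidable, that is, for none of them is there an algorithm which, given (descriptions of) automata of this type, halts if and only if the answer is yes. Given an automaton $M$ of the fixed type with input alphabet $A$: 1. emptiness: is $L(M)=\emptyset$? 2. finiteness: is $L(M)$ finite? 3. infiniteness: is $L(M)$ infinite? 4. universality: is $L(M)=A^*$? 5. regularity: is $L(M)$ a regular language? 6. context-freedom: is $L(M)$ a context-free language? Given two automata $M_1,M_2$ of the fixed type with the same input alphabet: 7. inclusion: is $L(M_1)\subseteq L(M_2)$? 8. equivalence: is $L(M_1)=L(M_2)$? -/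

import Mathlib

/-- The symbols on the input tape: an input symbol, or one of the two endmarkers. -/
abbrev TapeSymbol (A : Type) : Type := A ⊕ Bool

/-- The left endmarker. -/
abbrev TapeSymbol.left {A : Type} : TapeSymbol A := Sum.inr false

/-- The right endmarker. -/
abbrev TapeSymbol.right {A : Type} : TapeSymbol A := Sum.inr true

/-- A head scanning `a` may move by `d`: one square at most, and not beyond an endmarker. -/
def LegalMove {A : Type} (a : TapeSymbol A) (d : ℤ) : Prop :=
  (d = -1 ∨ d = 0 ∨ d = 1) ∧
    (a = TapeSymbol.left → d ≠ -1) ∧ (a = TapeSymbol.right → d ≠ 1)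

/-- A nondeterministic two-way `k`-head automaton with input symbols `A` and internal states `S`
(used with finite `A` and `S`). The partial transition function is undefined where `δ s a = ∅`. -/
structure MHFA (k : ℕ) (A S : Type) where
  /-- The transition function. -/
  δ : S → (Fin k → TapeSymbol A) → Set (S × (Fin k → ℤ))
  /-- The initial state. -/
  start : S
  /-- The accepting states. -/
  accept : Set S
  /-- Every transition moves the heads legally. -/
  legal : ∀ s a t, t ∈ δ s a → ∀ i, LegalMove (a i) (t.2 i)

/-- The symbol on square `j` of the tape with inscription `w`: square `0` holds the left endmarker,
squares `1, …, |w|` hold the symbols of `w`, and square `|w| + 1` the right endmarker. -/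
def tapeSymbol {A : Type} (w : List A) (j : Fin (w.length + 2)) : TapeSymbol A :=
  match (j : ℕ) with
  | 0 => TapeSymbol.left
  | i + 1 => (w[i]?).elim TapeSymbol.right Sum.inl

namespace MHFA

variable {k : ℕ} {A S : Type}

/-- A configuration on input `w`: the current state and the positions of the heads. -/
abbrev Config (k : ℕ) (S : Type) (w : List A) : Type := S × (Fin k → Fin (w.length + 2))

/-- The symbols scanned by the heads in a configuration. -/
def scanned {w : List A} (c : Config k S w) : Fin k → TapeSymbol A :=
  fun i => tapeSymbol w (c.2 i)

/-- The initial configuration: all heads are on square `1`. -/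
def init (M : MHFA k A S) (w : List A) : Config k S w :=
  (M.start, fun _ => 1)

/-- One step from a configuration to a successor configuration. -/
def Step (M : MHFA k A S) (w : List A) (c c' : Config k S w) : Prop :=
  ∃ d : Fin k → ℤ, (c'.1, d) ∈ M.δ c.1 (scanned c) ∧
    ∀ i, ((c'.2 i : ℕ) : ℤ) = ((c.2 i : ℕ) : ℤ) + d i

/-- `M` halts in a configuration if the transition function is undefined there. -/
def Halts (M : MHFA k A S) (w : List A) (c : Config k S w) : Prop :=
  M.δ c.1 (scanned c) = ∅

/-- The accepted language: some computation halts in an accepting state. -/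
def language (M : MHFA k A S) : Language A :=
  {w | ∃ c : Config k S w,
    Relation.ReflTransGen (M.Step w) (M.init w) c ∧ c.1 ∈ M.accept ∧ M.Halts w c}

/-- The transition function is everywhere undefined or a singleton. -/
def IsDeterministic (M : MHFA k A S) : Prop :=
  ∀ s a, (M.δ s a).Subsingleton

/-- No head ever moves to the left. -/
def IsOneWay (M : MHFA k A S) : Prop :=
  ∀ s a t, t ∈ M.δ s a → ∀ i, t.2 i ≠ -1

end MHFA

/-- The four types of `k`-head finite automata. -/
inductive HeadType
  | oneWayDeterministic
  | oneWayNondeterministic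
  | twoWayDeterministic
  | twoWayNondeterministic

/-- `M` is an automaton of the given type. -/
def MHFA.HasType {k : ℕ} {A S : Type} (M : MHFA k A S) : HeadType → Prop
  | HeadType.oneWayDeterministic => M.IsOneWay ∧ M.IsDeterministic
  | HeadType.oneWayNondeterministic => M.IsOneWay
  | HeadType.twoWayDeterministic => M.IsDeterministic
  | HeadType.twoWayNondeterministic => True

/-- The finite description `(m, s, F, T)` of a `k`-head automaton with states `0, …, m`, initial
state `s`, list of accepting states `F` and list of transitions `T`, where `((q, a), (q', d))`
stands for `(q', d) ∈ δ q a`. -/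
abbrev MHFACode (k : ℕ) : Type :=
  ℕ × ℕ × List ℕ × List ((ℕ × (Fin k → TapeSymbol ℕ)) × (ℕ × (Fin k → ℤ)))

/-- The automaton with input symbols `0, …, n - 1` described by a code. So that every code describes
an automaton, the initial state is read modulo the number of states, and list entries which are no
legal transitions (or no states) are ignored. -/
def MHFACode.toMHFA (n : ℕ) {k : ℕ} (c : MHFACode k) : MHFA k (Fin n) (Fin (c.1 + 1)) where
  δ q a := {t | (((q : ℕ), fun i => Sum.map Fin.val id (a i)), ((t.1 : ℕ), t.2)) ∈ c.2.2.2 ∧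
    ∀ i, LegalMove (a i) (t.2 i)}
  start := Fin.ofNat (c.1 + 1) c.2.1
  accept := {q | (q : ℕ) ∈ c.2.2.1}
  legal _ _ _ h := h.2

/-- The language over `{0, …, n - 1}` accepted by the automaton that a code describes. -/
def MHFACode.lang (n : ℕ) {k : ℕ} (c : MHFACode k) : Language (Fin n) :=
  (c.toMHFA n).language

/-- The problem with instances `I` and question `Q` is semi-decidable: some partial recursive
procedure, started on an instance, halts if and only if the answer is yes. Nothing is asked of its
behaviour on inputs that are not instances. -/
def SemiDecidableProblem {α : Type} [Primcodable α] (I Q : α → Prop) : Prop :=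
  ∃ R : α → Prop, REPred R ∧ ∀ x, I x → (R x ↔ Q x)

/-- The question `Q` about the language of a given automaton of type `t` is semi-decidable.
An instance is the size `n` of the alphabet with the description of an automaton over it. -/
def SemiDecidableFor (k : ℕ) (t : HeadType) (Q : ∀ n : ℕ, Language (Fin n) → Prop) : Prop :=
  SemiDecidableProblem (α := ℕ × MHFACode k)
    (fun x => (x.2.toMHFA x.1).HasType t)
    (fun x => Q x.1 (x.2.lang x.1))

/-- The question `Q` about the languages of two given automata of type `t` over a common alphabet
is semi-decidable. -/
def SemiDecidableForPairs (k : ℕ) (t : HeadType)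
    (Q : ∀ n : ℕ, Language (Fin n) → Language (Fin n) → Prop) : Prop :=
  SemiDecidableProblem (α := ℕ × MHFACode k × MHFACode k)
    (fun x => (x.2.1.toMHFA x.1).HasType t ∧ (x.2.2.toMHFA x.1).HasType t)
    (fun x => Q x.1 (x.2.1.lang x.1) (x.2.2.lang x.1))

/-! Two one-way heads can check the run of a queue machine. Let the tape hold all letters that ever
enter the queue, in order. One head stands on the first letter of the queue and reads; the other
stands just behind the last letter and compares the tape with the letters to be appended. The finite
control stores only the state and the letters still pending. If the machine never gets stuck, a
deterministic one-way automaton thus accepts exactly the histories at selected moments of the run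
(`QueueMachine.toCode_lang`). It is of all four types, and further heads stay at rest.

Queue machines are universal: a four-stack machine for partial recursive functions is simulated by
passes through a queue that holds the stacks. When it halts, the queue is erased and a counter
starts, which turns `bⁿ e` into `bⁿ⁺¹ e` forever. So the run on input `x` never gets stuck, and it
reaches the counter if and only if `x` lies in a halting set `D` whose complement is not recursively
enumerable (`QueueMachine.exists_universal`).

Stopping when the counter is about to be increased gives the empty language for `x ∉ D`. For `x ∈ D`
the lengths have unbounded gaps; as long words of regular and context-free languages can be
shortened by a bounded amount, the language is neither, and it is infinite. This settles emptiness,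
finiteness, regularity and context-freedom and, by comparison with the empty language, inclusion and
equivalence. The complement, available because the automaton always halts, settles universality.
Stopping whenever letters are pending before the counter starts gives an infinite language exactly
for `x ∉ D`, which settles infiniteness. Every answer is yes if and only if `x ∉ D`, and the
automata are computable from `x`. -/

/-! ### Languages with gaps are neither context-free nor regular -/

/-- The lengths of the words of `L` have arbitrarily long gaps, each of them closed by a word
of `L`. -/
def Language.HasGaps {α : Type} (L : Language α) : Prop :=
  ∀ p : ℕ, ∃ w ∈ L, p < w.length ∧ ∀ w' ∈ L, w'.length < w.length → w'.length + p < w.length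

namespace ContextFreeGrammar

variable {α : Type} {g : ContextFreeGrammar α}

/-- `g.Yields u w` means that the sentential form `u` derives the word `w`, as witnessed by a
forest of derivation trees. -/
inductive Yields (g : ContextFreeGrammar α) : List (Symbol α g.NT) → List α → Prop
  | nil : Yields g [] []
  | terminal (a : α) {u : List (Symbol α g.NT)} {w : List α} :
      Yields g u w → Yields g (Symbol.terminal a :: u) (a :: w)
  | nonterminal {r : ContextFreeRule α g.NT} {u : List (Symbol α g.NT)} {v w : List α} :
      r ∈ g.rules → Yields g r.output v → Yields g u w →
      Yields g (Symbol.nonterminal r.input :: u) (v ++ w)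

lemma Yields.derives {u : List (Symbol α g.NT)} {w : List α} (h : g.Yields u w) :
    g.Derives u (w.map Symbol.terminal) := by
  induction h with
  | nil => exact .refl _
  | terminal a _ ih => exact ih.append_left [Symbol.terminal a]
  | @nonterminal r u v w hr _ _ ihv ihw =>
    have h1 : g.Produces (Symbol.nonterminal r.input :: u) (r.output ++ u) := ⟨r, hr, .head u⟩
    rw [List.map_append]
    exact h1.trans_derives ((ihv.append_right u).trans (ihw.append_left _))

lemma Yields.append {u₁ u₂ : List (Symbol α g.NT)} {w₁ w₂ : List α}
    (h₁ : g.Yields u₁ w₁) (h₂ : g.Yields u₂ w₂) : g.Yields (u₁ ++ u₂) (w₁ ++ w₂) := by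
  induction h₁ with
  | nil => exact h₂
  | terminal a _ ih => exact .terminal a ih
  | nonterminal hr hv _ _ ih =>
    rw [List.append_assoc]
    exact .nonterminal hr hv ih

lemma Yields.exists_of_append {u₁ u₂ : List (Symbol α g.NT)} {w : List α}
    (h : g.Yields (u₁ ++ u₂) w) : ∃ w₁ w₂, w = w₁ ++ w₂ ∧ g.Yields u₁ w₁ ∧ g.Yields u₂ w₂ := by
  induction u₁ generalizing w with
  | nil => exact ⟨[], w, rfl, .nil, h⟩
  | cons s u₁ ih =>
    cases h with
    | terminal a h =>
      obtain ⟨w₁, w₂, rfl, h₁, h₂⟩ := ih h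
      exact ⟨a :: w₁, w₂, rfl, .terminal a h₁, h₂⟩
    | nonterminal hr hv h =>
      obtain ⟨w₁, w₂, rfl, h₁, h₂⟩ := ih h
      exact ⟨_ ++ w₁, w₂, (List.append_assoc ..).symm, .nonterminal hr hv h₁, h₂⟩

lemma yields_map_terminal (w : List α) : g.Yields (w.map Symbol.terminal) w := by
  induction w with
  | nil => exact .nil
  | cons a w ih => exact .terminal a ih

lemma Yields.of_derives {u : List (Symbol α g.NT)} {w : List α}
    (h : g.Derives u (w.map Symbol.terminal)) : g.Yields u w := by
  induction h using Relation.ReflTransGen.head_induction_on with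
  | refl => exact yields_map_terminal w
  | head h _ ih =>
    obtain ⟨r, hr, hrw⟩ := h
    obtain ⟨p, q, rfl, rfl⟩ := hrw.exists_parts
    rw [List.append_assoc] at ih
    obtain ⟨w₁, w₂, rfl, h₁, h₂⟩ := ih.exists_of_append
    obtain ⟨w₂, w₃, rfl, h₂, h₃⟩ := h₂.exists_of_append
    rw [List.append_assoc]
    exact h₁.append (.nonterminal hr h₂ h₃)

/-- A bound on how much has to be cut out of a long word in order to make it shorter. -/
lemma Yields.exists_shorter {m B : ℕ}
    (hm : ∀ r ∈ g.rules, ∀ v, g.Yields r.output v →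
      ∃ r' ∈ g.rules, ∃ v', r'.input = r.input ∧ g.Yields r'.output v' ∧ v'.length ≤ m)
    (hB : ∀ r ∈ g.rules, r.output.length ≤ B) {u : List (Symbol α g.NT)} {w : List α}
    (h : g.Yields u w) (hw : u.length * (m + 1) < w.length) :
    ∃ w', g.Yields u w' ∧ w'.length < w.length ∧ w.length ≤ w'.length + B * (m + 1) := by
  induction h with
  | nil => simp at hw
  | @terminal a u w _ ih =>
    obtain ⟨w', h1, h2, h3⟩ := ih (by simp only [List.length_cons, add_mul] at hw; omega)
    exact ⟨a :: w', .terminal a h1, by simpa using h2, by simp only [List.length_cons]; omega⟩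
  | @nonterminal r u v w hr hv hw' ihv ihw =>
    simp only [List.length_cons, List.length_append, add_mul] at hw
    by_cases h1 : u.length * (m + 1) < w.length
    · obtain ⟨w', h1, h2, h3⟩ := ihw h1
      refine ⟨v ++ w', .nonterminal hr hv h1, ?_, ?_⟩ <;> simp only [List.length_append] <;> omega
    by_cases h2 : r.output.length * (m + 1) < v.length
    · obtain ⟨v', h1, h2, h3⟩ := ihv h2
      refine ⟨v' ++ w, .nonterminal hr h1 hw', ?_, ?_⟩ <;> simp only [List.length_append] <;> omega
    -- Now `v` has more than `m + 1` letters, since `w` is short, but at most `B * (m + 1)`;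
    -- exchanging it for `v'` shortens the word within the bound.
    obtain ⟨r', hr', v', hi, hv', hl⟩ := hm r hr v hv
    have := Nat.mul_le_mul_right (m + 1) (hB r hr)
    refine ⟨v' ++ w, hi ▸ .nonterminal hr' hv' hw', ?_, ?_⟩ <;>
      simp only [List.length_append] <;> omega

end ContextFreeGrammar

namespace Language

variable {α : Type} {L : Language α}

/-- Pumping down is enough. The gap `(B + 1) * (m + 1)` is long enough for `Yields.exists_shorter`
to apply to the initial symbol, and larger than the amount `B * (m + 1)` that is cut out at most. -/
theorem HasGaps.not_isContextFree (hL : L.HasGaps) : ¬ L.IsContextFree := by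
  rintro ⟨g, rfl⟩
  have hm : ∃ m, ∀ r ∈ g.rules, ∀ v, g.Yields r.output v →
      ∃ r' ∈ g.rules, ∃ v', r'.input = r.input ∧ g.Yields r'.output v' ∧ v'.length ≤ m := by
    have h : ∀ r : ContextFreeRule α g.NT, ∃ m, ∀ v, g.Yields r.output v →
        ∃ v', g.Yields r.output v' ∧ v'.length ≤ m := fun r => by
      by_cases h : ∃ v, g.Yields r.output v
      · obtain ⟨v, hv⟩ := h
        exact ⟨v.length, fun _ _ => ⟨v, hv, le_rfl⟩⟩
      · exact ⟨0, fun v hv => (h ⟨v, hv⟩).elim⟩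
    choose f hf using h
    refine ⟨g.rules.sup f, fun r hr v hv => ?_⟩
    obtain ⟨v', h1, h2⟩ := hf r v hv
    exact ⟨r, hr, v', rfl, h1, h2.trans (Finset.le_sup hr)⟩
  obtain ⟨m, hm⟩ := hm
  set B := g.rules.sup fun r => r.output.length
  obtain ⟨w, hw, hp, hgap⟩ := hL ((B + 1) * (m + 1))
  have hB : ∀ r ∈ g.rules, r.output.length ≤ B := fun r hr =>
    Finset.le_sup (f := fun r : ContextFreeRule α g.NT => r.output.length) hr
  obtain ⟨w', h1, h2, h3⟩ := (ContextFreeGrammar.Yields.of_derives hw).exists_shorter hm hB (by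
    rw [add_mul] at hp
    simp only [List.length_singleton]
    omega)
  have := hgap w' h1.derives h2
  rw [add_mul] at this
  omega

/-- Omitting the loop of the pumping lemma removes at least one letter and at most as many as there
are states, too few to cross the gap. -/
theorem HasGaps.not_isRegular (hL : L.HasGaps) : ¬ L.IsRegular := by
  rintro ⟨σ, _, M, rfl⟩
  obtain ⟨w, hw, hp, hgap⟩ := hL (Fintype.card σ)
  obtain ⟨a, b, c, rfl, hl, hb, hsub⟩ := M.pumping_lemma hw hp.le
  have hmem : a ++ c ∈ M.accepts := hsub (by
    have : a ++ [] ++ c ∈ ({a} : Language α) * KStar.kstar ({b} : Language α) * {c} :=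
      Language.append_mem_mul (Language.append_mem_mul rfl (Language.nil_mem_kstar _)) rfl
    rw [List.append_nil] at this
    exact this)
  have hb := List.length_pos_of_ne_nil hb
  have := hgap _ hmem (by simp only [List.length_append]; omega)
  simp only [List.length_append] at this
  omega

theorem HasGaps.infinite (hL : L.HasGaps) : Set.Infinite (L : Set (List α)) := by
  intro h
  obtain ⟨p, hp⟩ := (h.image List.length).bddAbove
  obtain ⟨w, hw, hpw, -⟩ := hL p
  exact absurd (hp ⟨w, hw, rfl⟩) (by omega)

end Language

/-! ### Queue machines and their histories -/

/-- A configuration of a queue machine: the letters still to be appended, the state, the letters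
read so far, and the letters in the queue. -/
structure QueueCfg (A Q : Type) where
  /-- The letters that are to be appended to the queue before the next letter is read. -/
  pend : List A
  /-- The state. -/
  state : Q
  /-- The letters that were read. -/
  read : List A
  /-- The letters in the queue. -/
  queue : List A

/-- A queue machine in state `q` reads the first letter `x` of its queue and appends the word
`(δ q x).1` to the queue, letter by letter, while it changes to the state `(δ q x).2`. -/
abbrev QueueMachine (A Q : Type) : Type := Q → A → List A × Q

namespace QueueCfg

variable {A Q : Type}

/-- All letters that have ever been in the queue. -/
def history (c : QueueCfg A Q) : List A := c.read ++ c.queue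

/-- The queue machine has to read a letter, but the queue is empty. -/
def Stuck (c : QueueCfg A Q) : Prop := c.pend = [] ∧ c.queue = []

/-- Rename letters and states. -/
def map {A' Q' : Type} (f : A → A') (g : Q → Q') (c : QueueCfg A Q) : QueueCfg A' Q' :=
  ⟨c.pend.map f, g c.state, c.read.map f, c.queue.map f⟩

end QueueCfg

namespace QueueMachine

variable {A Q : Type} (δ : QueueMachine A Q)

/-- One step of a queue machine. -/
def step : QueueCfg A Q → QueueCfg A Q
  | ⟨[], q, r, []⟩ => ⟨[], q, r, []⟩
  | ⟨[], q, r, x :: u⟩ => ⟨(δ q x).1, (δ q x).2, r ++ [x], u⟩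
  | ⟨x :: l, q, r, u⟩ => ⟨l, q, r, u ++ [x]⟩

/-- The configuration after `i` steps of the queue machine that starts in state `q` by appending
`w` to the empty queue. -/
def run (w : List A) (q : Q) (i : ℕ) : QueueCfg A Q := (step δ)^[i] ⟨w, q, [], []⟩

variable {δ}

lemma run_succ (w : List A) (q : Q) (i : ℕ) : run δ w q (i + 1) = step δ (run δ w q i) :=
  Function.iterate_succ_apply' ..

lemma run_add (w : List A) (q : Q) (i j : ℕ) : run δ w q (i + j) = (step δ)^[j] (run δ w q i) := by
  rw [run, run, add_comm, Function.iterate_add_apply]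

lemma step_eq_self {c : QueueCfg A Q} (h : c.Stuck) : step δ c = c := by
  obtain ⟨_, q, r, _⟩ := c
  obtain ⟨rfl, rfl⟩ := h
  rfl

lemma history_prefix_step (c : QueueCfg A Q) : c.history <+: (step δ c).history := by
  obtain ⟨_ | ⟨x, l⟩, q, r, _ | ⟨y, u⟩⟩ := c <;> simp [step, QueueCfg.history]

lemma history_prefix_run {w : List A} {q : Q} {i j : ℕ} (h : i ≤ j) :
    (run δ w q i).history <+: (run δ w q j).history := by
  induction h with
  | refl => exact List.prefix_rfl
  | step _ ih =>
    rw [run_succ]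
    exact ih.trans (history_prefix_step _)

/-- A state that is never left stays forever. -/
lemma state_of_le {w : List A} {q g : Q} (hg : ∀ x, (δ g x).2 = g) {i j : ℕ} (h : i ≤ j)
    (hi : (run δ w q i).state = g) : (run δ w q j).state = g := by
  induction h with
  | refl => exact hi
  | @step j _ ih =>
    rw [run_succ]
    generalize run δ w q j = c at ih
    obtain ⟨_ | ⟨x, l⟩, q, r, _ | ⟨y, u⟩⟩ := c <;> simp_all [step]

/-- A queue machine that is infinitely often not stuck is never stuck. -/
lemma not_stuck {w : List A} {q : Q} (h : ∀ n, ∃ i ≥ n, ¬ (run δ w q i).Stuck) (i : ℕ) :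
    ¬ (run δ w q i).Stuck := by
  intro hi
  obtain ⟨j, hij, hj⟩ := h i
  have : ∀ k, run δ w q (i + k) = run δ w q i := fun k => by
    rw [run_add]
    exact Function.iterate_fixed (step_eq_self hi) k
  obtain ⟨k, rfl⟩ := Nat.exists_eq_add_of_le hij
  rw [this] at hj
  exact hj hi

lemma step_map {A' Q' : Type} {δ' : QueueMachine A' Q'} {f : A → A'} {g : Q → Q'}
    (h : ∀ q x, δ' (g q) (f x) = ((δ q x).1.map f, g (δ q x).2)) (c : QueueCfg A Q) :
    step δ' (c.map f g) = (step δ c).map f g := by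
  obtain ⟨_ | ⟨x, l⟩, q, r, _ | ⟨y, u⟩⟩ := c <;> simp [step, QueueCfg.map, h]

/-- This transports a machine with structured letters and states to `Fin n` and `Fin m`. -/
lemma run_map {A' Q' : Type} {δ' : QueueMachine A' Q'} {f : A → A'} {g : Q → Q'}
    (h : ∀ q x, δ' (g q) (f x) = ((δ q x).1.map f, g (δ q x).2)) (w : List A) (q : Q) (i : ℕ) :
    run δ' (w.map f) (g q) i = (run δ w q i).map f g := by
  induction i with
  | zero => rfl
  | succ i ih => rw [run_succ, run_succ, ih, step_map h]

/-- The length of the history is at least half of the number of steps. -/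
lemma le_length_history {w : List A} {q : Q} (h : ∀ i, ¬ (run δ w q i).Stuck) (i : ℕ) :
    i ≤ 2 * (run δ w q i).history.length := by
  -- A step that is not stuck either reads a letter or appends one, so it raises exactly one of the
  -- two lengths.
  have key : ∀ i, i = (run δ w q i).read.length + (run δ w q i).history.length := fun i => by
    induction i with
    | zero => rfl
    | succ i ih =>
      have := h i
      rw [run_succ]
      generalize run δ w q i = c at this ih
      obtain ⟨_ | ⟨x, l⟩, q, r, _ | ⟨y, u⟩⟩ := c <;>
        simp [step, QueueCfg.history, QueueCfg.Stuck] at this ih ⊢ <;> omega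
  have h1 := key i
  have h2 : (run δ w q i).read.length ≤ (run δ w q i).history.length := by
    simp [QueueCfg.history]
  omega

/-- The words that are obtained by stopping a run at the configurations for which the pair of the
pending word and the state belongs to `T`. -/
def histories (δ : QueueMachine A Q) (w : List A) (q : Q) (T : Set (List A × Q)) : Language A :=
  {v | ∃ i, ((run δ w q i).pend, (run δ w q i).state) ∈ T ∧ (run δ w q i).history = v}

/-- A run that never stops and never visits `g` has infinitely many histories. -/
lemma histories_infinite {w : List A} {q g : Q} (h : ∀ i, ¬ (run δ w q i).Stuck)
    (hg : ∀ i, (run δ w q i).state ≠ g) :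
    Set.Infinite (histories δ w q {p | p.1 ≠ [] ∧ p.2 ≠ g} : Set (List A)) := by
  -- Otherwise the machine only reads from `n` on, and a constant history contradicts
  -- `le_length_history`.
  have hw : ∀ n, ∃ i ≥ n, (run δ w q i).pend ≠ [] := fun n => by
    by_contra! hc
    have h1 : ∀ k, (run δ w q (n + k)).history = (run δ w q n).history := fun k => by
      induction k with
      | zero => rfl
      | succ k ih =>
        have h2 := hc (n + k) (by omega)
        rw [← ih, ← add_assoc, run_succ]
        generalize run δ w q (n + k) = c at h2
        obtain ⟨_ | ⟨x, l⟩, q, r, _ | ⟨y, u⟩⟩ := c <;>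
          simp_all [step, QueueCfg.history]
    have h2 := le_length_history h (n + (2 * (run δ w q n).history.length + 1))
    rw [h1] at h2
    omega
  intro hfin
  obtain ⟨p, hp⟩ := (hfin.image List.length).bddAbove
  obtain ⟨i, hi, hpend⟩ := hw (2 * p + 2)
  have h1 := le_length_history h i
  have h2 := hp ⟨_, ⟨i, ⟨hpend, hg i⟩, rfl⟩, rfl⟩
  omega

/-- A run that visits `g` and never leaves it has finitely many histories before. -/
lemma histories_finite {w : List A} {q g : Q} {T : Set (List A × Q)} (hT : ∀ p ∈ T, p.2 ≠ g)
    (h : ∀ x, (δ g x).2 = g) {i : ℕ} (hi : (run δ w q i).state = g) :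
    Set.Finite (histories δ w q T : Set (List A)) := by
  refine ((Set.finite_lt_nat i).image fun j => (run δ w q j).history).subset ?_
  rintro v ⟨j, hj, rfl⟩
  refine ⟨j, ?_, rfl⟩
  by_contra hij
  exact hT _ hj (state_of_le h (not_lt.1 hij) hi)

/-! ### Counters -/

/-- In state `g`, the queue machine copies words `bⁿ #`, adding one letter `b` each time. -/
structure IsCounter (δ : QueueMachine A Q) (b e : A) (g : Q) : Prop where
  ne : b ≠ e
  copy : δ g b = ([b], g)
  wrap : δ g e = ([b, e], g)
  stay : ∀ x, (δ g x).2 = g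

open List in
/-- One round of a counter. -/
lemma IsCounter.round {b e : A} {g : Q} (h : IsCounter δ b e g) (s t : ℕ) (r : List A) :
    ∃ n, (step δ)^[n] ⟨[], g, r, replicate s b ++ e :: replicate t b⟩ =
        ⟨[b, e], g, r ++ replicate s b ++ [e], replicate (t + s) b⟩ ∧
      ∀ m < n, ((step δ)^[m] ⟨[], g, r, replicate s b ++ e :: replicate t b⟩).pend ≠ [b, e] := by
  induction s generalizing t r with
  | zero =>
    refine ⟨1, by simp [step, h.wrap], fun m hm => ?_⟩
    obtain rfl : m = 0 := by omega
    simp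
  | succ s ih =>
    obtain ⟨n, h1, h2⟩ := ih (t + 1) (r ++ [b])
    have h0 : (step δ)^[2] ⟨[], g, r, replicate (s + 1) b ++ e :: replicate t b⟩ =
        ⟨[], g, r ++ [b], replicate s b ++ e :: replicate (t + 1) b⟩ := by
      simp [step, h.copy, replicate_succ, ← replicate_succ']
    refine ⟨n + 2, ?_, fun m hm => ?_⟩
    · rw [Function.iterate_add_apply, h0, h1]
      simp [replicate_succ]
      omega
    · match m with
      | 0 => simp
      | 1 => simp [step, replicate_succ, h.copy]
      | m + 2 =>
        rw [Function.iterate_add_apply, h0]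
        exact h2 m (by omega)

open List in
/-- Two consecutive marked configurations of a counter. -/
lemma IsCounter.next {b e : A} {g : Q} (h : IsCounter δ b e g) {w : List A} {q : Q} {i n : ℕ}
    {r : List A} (hi : run δ w q i = ⟨[b, e], g, r, replicate n b⟩) :
    ∃ j > i, ∃ r', run δ w q j = ⟨[b, e], g, r', replicate (n + 1) b⟩ ∧
      r'.length = r.length + n + 2 ∧ ∀ m, i < m → m < j → (run δ w q m).pend ≠ [b, e] := by
  have h0 : (step δ)^[2] ⟨[b, e], g, r, replicate n b⟩ =
      ⟨[], g, r, replicate (n + 1) b ++ e :: replicate 0 b⟩ := by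
    simp [step, replicate_succ']
  obtain ⟨k, h1, h2⟩ := h.round (n + 1) 0 r
  refine ⟨i + (k + 2), by omega, r ++ replicate (n + 1) b ++ [e], ?_, ?_, fun m him hmj => ?_⟩
  · rw [run_add, hi, Function.iterate_add_apply, h0, h1, zero_add]
  · simp
    omega
  · obtain ⟨m, rfl⟩ := Nat.exists_eq_add_of_le him.le
    match m with
    | 0 => omega
    | 1 =>
      rw [run_succ, hi]
      simp [step]
    | m + 2 =>
      rw [run_add, hi, Function.iterate_add_apply, h0]
      exact h2 m (by omega)

open List in
lemma IsCounter.exists_run {b e : A} {g : Q} (h : IsCounter δ b e g) {w : List A} {q : Q} {i : ℕ}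
    {r : List A} (hi : run δ w q i = ⟨[b, e], g, r, []⟩) (n : ℕ) :
    ∃ j ≥ n, ∃ r', run δ w q j = ⟨[b, e], g, r', replicate n b⟩ := by
  induction n with
  | zero => exact ⟨i, Nat.zero_le _, r, hi⟩
  | succ n ih =>
    obtain ⟨j, hj, r, hr⟩ := ih
    obtain ⟨j', hj', r', hr', -⟩ := h.next hr
    exact ⟨j', by omega, r', hr'⟩

/-- The words that are written when a counter is about to be increased have gaps. -/
theorem IsCounter.hasGaps {b e : A} {g : Q} (h : IsCounter δ b e g) {w : List A} {q : Q} {i : ℕ}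
    {r : List A} (hi : run δ w q i = ⟨[b, e], g, r, []⟩) :
    (histories δ w q {([b, e], g)}).HasGaps := by
  intro p
  -- The round that starts with `p` letters in the queue lengthens the history from `r.length + p`
  -- to `r.length + 2 * p + 3`.
  obtain ⟨j, -, r, hr⟩ := h.exists_run hi p
  obtain ⟨j', hj', r', hr', hl, hm⟩ := h.next hr
  refine ⟨_, ⟨j', by rw [hr']; rfl, rfl⟩, ?_, ?_⟩
  · simp [hr', QueueCfg.history]
    omega
  · rintro _ ⟨k, hk, rfl⟩ hlt
    -- Histories only grow, so a shorter one is earlier; no marked moment lies strictly between `j`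
    -- and `j'`.
    have h1 : k < j' := by
      by_contra hc
      exact absurd (history_prefix_run (δ := δ) (w := w) (q := q) (not_lt.1 hc)).length_le
        (not_le.2 hlt)
    have h2 : k ≤ j := by
      by_contra hc
      exact hm k (not_le.1 hc) h1 (congrArg Prod.fst hk)
    have h3 := (history_prefix_run (δ := δ) (w := w) (q := q) h2).length_le
    rw [hr] at h3
    simp only [hr', QueueCfg.history, List.length_append, List.length_replicate] at h3 ⊢
    omega

/-- In state `q`, when its queue is `u`, the machine comes to state `q'` with queue `u'` after at
least one step, at a point of time at which it reads a letter. -/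
def Leads (δ : QueueMachine A Q) (q : Q) (u : List A) (q' : Q) (u' : List A) : Prop :=
  ∀ r, ∃ n > 0, ∃ r', (step δ)^[n] ⟨[], q, r, u⟩ = ⟨[], q', r', u'⟩

lemma Leads.trans {q q' q'' : Q} {u u' u'' : List A} (h : Leads δ q u q' u')
    (h' : Leads δ q' u' q'' u'') : Leads δ q u q'' u'' := by
  intro r
  obtain ⟨n, hn, r', hr⟩ := h r
  obtain ⟨m, hm, r'', hr'⟩ := h' r'
  exact ⟨m + n, by omega, r'', by rw [Function.iterate_add_apply, hr, hr']⟩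

lemma iterate_step_append (l : List A) (q : Q) (r u : List A) (l' : List A) :
    (step δ)^[l.length] ⟨l ++ l', q, r, u⟩ = ⟨l', q, r, u ++ l⟩ := by
  induction l generalizing u with
  | nil => simp
  | cons x l ih => simpa [step] using ih (u ++ [x])

lemma leads_read (q : Q) (x : A) (u : List A) : Leads δ q (x :: u) (δ q x).2 (u ++ (δ q x).1) := by
  intro r
  refine ⟨(δ q x).1.length + 1, by omega, r ++ [x], ?_⟩
  simpa [step] using iterate_step_append (δ := δ) (δ q x).1 (δ q x).2 (r ++ [x]) u []

end QueueMachine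

/-! ### Simulation of four stacks by a queue -/

open Turing.PartrecToTM2 in
/-- A machine with four stacks. In each step it replaces the top symbol of one stack by a word. -/
structure StackMachine (Γ Λ : Type) where
  /-- The stack on which a state operates. -/
  stk : Λ → K'
  /-- The word that replaces the top symbol. -/
  out : Λ → Option Γ → List Γ
  /-- The next state. -/
  next : Λ → Option Γ → Λ
  /-- The halting states. -/
  halted : Set Λ

namespace StackMachine

open Turing.PartrecToTM2

variable {Γ Λ : Type}

open Classical in
/-- One step of a stack machine. -/
noncomputable def step (M : StackMachine Γ Λ) (c : Λ × (K' → List Γ)) :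
    Option (Λ × (K' → List Γ)) :=
  if c.1 ∈ M.halted then none else
    some (M.next c.1 (c.2 (M.stk c.1)).head?,
      Function.update c.2 (M.stk c.1)
        (M.out c.1 (c.2 (M.stk c.1)).head? ++ (c.2 (M.stk c.1)).tail))

/-- The states of the queue machine that simulates a stack machine: a pass through the queue
consists of scanning for the stack on which to operate, and of copying the rest. When the stack
machine has halted, the queue is erased, and the queue machine goes on as a counter. -/
inductive QueueState (Λ : Type)
  | scan (q : Λ) (k : K')
  | copy (q : Λ) (k : K')
  | erase (k : K')
  | count

instance [Finite Λ] : Finite (QueueState Λ) := by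
  have : Finite K' := Finite.of_injective
    (fun k => match k with | .main => (0 : Fin 4) | .rev => 1 | .aux => 2 | .stack => 3)
    fun x y h => by cases x <;> cases y <;> simp_all
  let f : QueueState Λ → (Λ × K') ⊕ (Λ × K') ⊕ K' ⊕ Unit
    | .scan q k => .inl (q, k)
    | .copy q k => .inr (.inl (q, k))
    | .erase k => .inr (.inr (.inl k))
    | .count => .inr (.inr (.inr ()))
  refine Finite.of_injective f fun x y h => ?_
  cases x <;> cases y <;> simp_all [f]

/-- The stack that follows in the encoding of a configuration. -/
def nextStack : K' → Option K'
  | .main => some .rev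
  | .rev => some .aux
  | .aux => some .stack
  | .stack => none

variable (M : StackMachine Γ Λ)

open Classical in
/-- The state in which a pass begins. -/
noncomputable def passStart (q : Λ) : QueueState Λ :=
  if q ∈ M.halted then .erase .main else .scan q .main

/-- The state after the copying of a stack. -/
noncomputable def afterCopy (q : Λ) (k : K') : QueueState Λ :=
  (nextStack k).elim (M.passStart q) (.copy q)

/-- The queue machine that simulates a stack machine. -/
noncomputable def toQueue (b : Γ) : QueueMachine (Option Γ) (QueueState Λ)
  | .scan q k, none =>
    if k = M.stk q then ((M.out q none).map some ++ [none], M.afterCopy (M.next q none) k)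
    -- The default value plays no role in the simulation: the scan meets the stack `M.stk q` at the
    -- latest on the fourth stack.
    else ([none], .scan q ((nextStack k).getD .main))
  | .scan q k, some a =>
    if k = M.stk q then ((M.out q (some a)).map some, .copy (M.next q (some a)) k)
    else ([some a], .scan q k)
  | .copy q k, none => ([none], M.afterCopy q k)
  | .copy q k, some a => ([some a], .copy q k)
  | .erase k, none => (nextStack k).elim ([some b, none], .count) fun k => ([], .erase k)
  | .erase k, some _ => ([], .erase k)
  | .count, none => ([some b, none], .count)
  | .count, some a => ([some a], .count)

/-- A stack is written into the queue, followed by a separator. -/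
def encodeStack (l : List Γ) : List (Option Γ) := l.map some ++ [none]

/-- The contents of the queue for given stacks. -/
def encodeStacks (S : K' → List Γ) : List (Option Γ) :=
  encodeStack (S .main) ++ encodeStack (S .rev) ++ encodeStack (S .aux) ++ encodeStack (S .stack)

variable {M} {b : Γ}

lemma isCounter : (M.toQueue b).IsCounter (some b) none .count :=
  ⟨by simp, rfl, rfl, by rintro (_ | a) <;> rfl⟩

/-- A pass over one stack by a state that is left only at the separator; copying, scanning and
erasing are instances with different `f` and `y`. -/
lemma leads_map_some {p p' : QueueState Λ} {f : Γ → List (Option Γ)} {y : List (Option Γ)}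
    (hp : ∀ a, M.toQueue b p (some a) = (f a, p)) (hp' : M.toQueue b p none = (y, p'))
    (l : List Γ) (u : List (Option Γ)) :
    (M.toQueue b).Leads p (encodeStack l ++ u) p' (u ++ (l.flatMap f ++ y)) := by
  induction l generalizing u with
  | nil =>
    have := QueueMachine.leads_read (δ := M.toQueue b) p none u
    rw [hp'] at this
    exact this
  | cons a l ih =>
    have := QueueMachine.leads_read (δ := M.toQueue b) p (some a) (encodeStack l ++ u)
    rw [hp] at this
    have h := ih (u ++ f a)
    simp only [List.flatMap_cons, List.append_assoc] at h this ⊢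
    exact this.trans h

lemma leads_copy (q : Λ) (k : K') (l : List Γ) (u : List (Option Γ)) :
    (M.toQueue b).Leads (.copy q k) (encodeStack l ++ u) (M.afterCopy q k)
      (u ++ encodeStack l) := by
  simpa [encodeStack, List.map_eq_flatMap]
    using leads_map_some (M := M) (b := b) (p := .copy q k)
    (fun _ => rfl) rfl l u

lemma leads_scan {q : Λ} {k k' : K'} (hk : k ≠ M.stk q) (hk' : nextStack k = some k')
    (l : List Γ) (u : List (Option Γ)) :
    (M.toQueue b).Leads (.scan q k) (encodeStack l ++ u) (.scan q k') (u ++ encodeStack l) := by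
  simpa [encodeStack, List.map_eq_flatMap]
    using leads_map_some (M := M) (b := b) (p := .scan q k)
    (p' := .scan q k') (f := fun a => [some a]) (y := [none])
    (fun _ => by simp [toQueue, hk]) (by simp [toQueue, hk, hk']) l u

lemma leads_erase {k k' : K'} (hk : nextStack k = some k') (l : List Γ) (u : List (Option Γ)) :
    (M.toQueue b).Leads (.erase k) (encodeStack l ++ u) (.erase k') u := by
  simpa [List.flatMap_eq_nil_iff.2]
    using leads_map_some (M := M) (b := b) (p := .erase k) (p' := .erase k')
    (f := fun _ => []) (y := []) (fun _ => rfl) (by simp [toQueue, hk]) l u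

lemma leads_operate {q : Λ} {k : K'} (hk : k = M.stk q) (l : List Γ) (u : List (Option Γ)) :
    (M.toQueue b).Leads (.scan q k) (encodeStack l ++ u) (M.afterCopy (M.next q l.head?) k)
      (u ++ encodeStack (M.out q l.head? ++ l.tail)) := by
  cases l with
  | nil =>
    have := QueueMachine.leads_read (δ := M.toQueue b) (.scan q k) none u
    simpa [toQueue, hk, encodeStack] using this
  | cons a l =>
    have h1 := QueueMachine.leads_read (δ := M.toQueue b) (.scan q k) (some a) (encodeStack l ++ u)
    have h2 := leads_copy (M := M) (b := b) (M.next q (some a)) k l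
      (u ++ (M.out q (some a)).map some)
    simp only [toQueue, hk, if_true] at h1 h2
    rw [List.append_assoc] at h1
    have := h1.trans h2
    simpa [encodeStack, hk] using this

/-- The simulation of one step of the stack machine. -/
lemma leads_of_step {c c' : Λ × (K' → List Γ)} (h : M.step c = some c') :
    (M.toQueue b).Leads (M.passStart c.1) (encodeStacks c.2) (M.passStart c'.1)
      (encodeStacks c'.2) := by
  obtain ⟨q, S⟩ := c
  unfold step at h
  split_ifs at h with hq
  obtain rfl := Option.some_injective _ h
  simp only [passStart, if_neg hq]
  rw [← passStart]
  simp only [encodeStacks, List.append_assoc]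
  have e : ∀ (p : Λ) k k', nextStack k = some k' → M.afterCopy p k = .copy p k' := fun p k k' h => by
    simp [afterCopy, h]
  have e' : ∀ p : Λ, M.afterCopy p .stack = M.passStart p := fun p => rfl
  generalize hk : M.stk q = k
  have op := leads_operate (M := M) (b := b) (q := q) hk.symm (S k)
  have sc : ∀ k' k'', nextStack k' = some k'' → k' ≠ k → ∀ l u, (M.toQueue b).Leads (.scan q k')
      (encodeStack l ++ u) (.scan q k'') (u ++ encodeStack l) := fun k' k'' h h' =>
    leads_scan (hk ▸ h') h
  set q' := M.next q (S k).head?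
  set l' := M.out q (S k).head? ++ (S k).tail
  have cp := leads_copy (M := M) (b := b) q'
  have h0 := e q' .main .rev rfl
  have h1 := e q' .rev .aux rfl
  have h2 := e q' .aux .stack rfl
  cases k
  · refine (op _).trans ?_
    rw [h0]
    simp only [List.append_assoc]
    refine (cp _ _ _).trans ?_
    rw [h1]
    simp only [List.append_assoc]
    refine (cp _ _ _).trans ?_
    rw [h2]
    simp only [List.append_assoc]
    simpa [e'] using cp .stack (S .stack) (encodeStack l' ++ (encodeStack (S .rev) ++
      encodeStack (S .aux)))
  · refine (sc .main .rev rfl (by simp) _ _).trans ?_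
    simp only [List.append_assoc]
    refine (op _).trans ?_
    rw [h1]
    simp only [List.append_assoc]
    refine (cp _ _ _).trans ?_
    rw [h2]
    simp only [List.append_assoc]
    simpa [e'] using cp .stack (S .stack) (encodeStack (S .main) ++ (encodeStack l' ++
      encodeStack (S .aux)))
  · refine (sc .main .rev rfl (by simp) _ _).trans ?_
    simp only [List.append_assoc]
    refine (sc .rev .aux rfl (by simp) _ _).trans ?_
    simp only [List.append_assoc]
    refine (op _).trans ?_
    rw [h2]
    simp only [List.append_assoc]
    simpa [e'] using cp .stack (S .stack) (encodeStack (S .main) ++ (encodeStack (S .rev) ++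
      encodeStack l'))
  · refine (sc .main .rev rfl (by simp) _ _).trans ?_
    simp only [List.append_assoc]
    refine (sc .rev .aux rfl (by simp) _ _).trans ?_
    simp only [List.append_assoc]
    refine (sc .aux .stack rfl (by simp) _ _).trans ?_
    simp only [List.append_assoc]
    simpa [e'] using op (encodeStack (S .main) ++ (encodeStack (S .rev) ++ encodeStack (S .aux)))

/-- The erasure of the queue. -/
lemma leads_erase_stacks (S : K' → List Γ) :
    (M.toQueue b).Leads (.erase .main) (encodeStacks S) (.erase .stack) (encodeStack (S .stack)) := by
  simp only [encodeStacks, List.append_assoc]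
  exact (leads_erase rfl _ _).trans ((leads_erase rfl _ _).trans (leads_erase rfl _ _))

/-- The simulation starts when the initial configuration has been written into the queue. -/
lemma run_encodeStacks (p : QueueState Λ) (S : K' → List Γ) :
    (M.toQueue b).run (encodeStacks S) p (encodeStacks S).length = ⟨[], p, [], encodeStacks S⟩ := by
  simpa [QueueMachine.run] using
    QueueMachine.iterate_step_append (δ := M.toQueue b) (encodeStacks S) p [] [] []

lemma exists_run_of_leads {w : List (Option Γ)} {p p' p'' : QueueState Λ}
    {u u' r : List (Option Γ)} {i : ℕ} (h : (M.toQueue b).run w p'' i = ⟨[], p, r, u⟩)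
    (h' : (M.toQueue b).Leads p u p' u') :
    ∃ j > i, ∃ r', (M.toQueue b).run w p'' j = ⟨[], p', r', u'⟩ := by
  obtain ⟨n, hn, r', hr'⟩ := h' r
  exact ⟨i + n, by omega, r', by rw [QueueMachine.run_add, h, hr']⟩

lemma exists_run_of_reaches {c c' : Λ × (K' → List Γ)} (h : StateTransition.Reaches M.step c c') :
    ∃ i r, (M.toQueue b).run (encodeStacks c.2) (M.passStart c.1) i =
      ⟨[], M.passStart c'.1, r, encodeStacks c'.2⟩ := by
  induction h with
  | refl => exact ⟨_, _, run_encodeStacks _ _⟩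
  | tail _ h ih =>
    obtain ⟨i, r, hr⟩ := ih
    obtain ⟨j, -, r', hr'⟩ :=
        exists_run_of_leads hr (leads_of_step h)
    exact ⟨j, r', hr'⟩

/-- If the stack machine halts, the counter of the queue machine is started. -/
theorem exists_run_of_dom {c : Λ × (K' → List Γ)} (h : (StateTransition.eval M.step c).Dom) :
    ∃ i r, (M.toQueue b).run (encodeStacks c.2) (M.passStart c.1) i =
      ⟨[some b, none], .count, r, []⟩ := by
  obtain ⟨c', hc'⟩ := Part.dom_iff_mem.1 h
  obtain ⟨h1, h2⟩ := StateTransition.mem_eval.1 hc'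
  obtain ⟨i, r, hr⟩ :=
        exists_run_of_reaches (b := b) h1
  have hq : c'.1 ∈ M.halted := by
    by_contra hq
    simp [step, hq] at h2
  rw [show M.passStart c'.1 = .erase .main from if_pos hq] at hr
  obtain ⟨j, -, r', hr'⟩ :=
        exists_run_of_leads hr (leads_erase_stacks c'.2)
  -- The fourth stack is treated by hand: `Leads` ends with no letter pending, whereas here the run
  -- has to be stopped with `[some b, none]` pending.
  have : ∀ (l : List Γ) r, ∃ n r', (QueueMachine.step (M.toQueue b))^[n]
      ⟨[], .erase .stack, r, encodeStack l⟩ = ⟨[some b, none], .count, r', []⟩ := fun l => by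
    induction l with
    | nil => exact fun r => ⟨1, _, rfl⟩
    | cons a l ih =>
      intro r
      obtain ⟨n, r', h⟩ := ih (r ++ [some a])
      exact ⟨n + 1, r', h⟩
  obtain ⟨n, r'', hn⟩ := this (c'.2 .stack) r'
  exact ⟨j + n, r'', by rw [QueueMachine.run_add, hr', hn]⟩

/-- If the stack machine does not halt, then the queue machine simulates infinitely many steps. -/
theorem exists_run_of_not_dom {c : Λ × (K' → List Γ)}
    (h : ¬ (StateTransition.eval M.step c).Dom) (n : ℕ) :
    ∃ i ≥ n, ∃ q r S, (M.toQueue b).run (encodeStacks c.2) (M.passStart c.1) i =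
      ⟨[], .scan q .main, r, encodeStacks S⟩ := by
  have hs : ∀ c', StateTransition.Reaches M.step c c' → ∃ c'', M.step c' = some c'' := by
    intro c' hc'
    rw [← Option.isSome_iff_exists, Option.isSome_iff_ne_none]
    exact fun h' => h (Part.dom_iff_mem.2 ⟨c', StateTransition.mem_eval.2 ⟨hc', h'⟩⟩)
  have key : ∃ i ≥ n, ∃ c', StateTransition.Reaches M.step c c' ∧ ∃ r,
      (M.toQueue b).run (encodeStacks c.2) (M.passStart c.1) i =
        ⟨[], M.passStart c'.1, r, encodeStacks c'.2⟩ := by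
    induction n with
    | zero => exact ⟨_, Nat.zero_le _, c, .refl, _, run_encodeStacks _ _⟩
    | succ n ih =>
      obtain ⟨i, hi, c', hc', r, hr⟩ := ih
      obtain ⟨c'', hc''⟩ := hs c' hc'
      obtain ⟨j, hj, r', hr'⟩ :=
        exists_run_of_leads hr (leads_of_step hc'')
      exact ⟨j, by omega, c'', hc'.tail hc'', r', hr'⟩
  obtain ⟨i, hi, c', hc', r, hr⟩ := key
  obtain ⟨c'', hc''⟩ := hs c' hc'
  have hq : c'.1 ∉ M.halted := fun hq => by simp [step, hq] at hc''
  rw [show M.passStart c'.1 = .scan c'.1 .main from if_neg hq] at hr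
  exact ⟨i, hi, _, r, _, hr⟩

end StackMachine

/-! ### A universal stack machine with finitely many states -/

namespace StackMachine

open Turing Turing.PartrecToTM2 StateTransition

variable {Γ Λ σ : Type}

/-- The restriction of a stack machine to a set of states that is closed under transitions. -/
def restrict (M : StackMachine Γ Λ) (P : Set Λ) (hP : ∀ q ∈ P, ∀ o, M.next q o ∈ P) :
    StackMachine Γ P where
  stk q := M.stk q
  out q := M.out q
  next q o := ⟨M.next q o, hP q q.2 o⟩
  halted := {q | (q : Λ) ∈ M.halted}

lemma restrict_respects (M : StackMachine Γ Λ) (P : Set Λ) (hP : ∀ q ∈ P, ∀ o, M.next q o ∈ P) :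
    Respects M.step (M.restrict P hP).step fun c c' => c = (c'.1.1, c'.2) := by
  rintro _ ⟨⟨q, hq⟩, S⟩ rfl
  by_cases h : q ∈ M.halted
  · simp [step, restrict, h]
  · simp only [step, h, if_false]
    refine ⟨_, ?_, .single (show _ = _ from if_neg h)⟩
    rfl

/-- The stack on which a statement operates. -/
def stmtStack : TM2.Stmt (fun _ : K' => Γ) Λ σ → K'
  | .push k _ _ => k
  | .peek k _ _ => k
  | .pop k _ _ => k
  | _ => .main

/-- The word by which a statement replaces the top symbol of a stack. -/
def stmtOut : TM2.Stmt (fun _ : K' => Γ) Λ σ → σ → Option Γ → List Γ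
  | .push _ f _, v, o => f v :: o.toList
  | .pop _ _ _, _, _ => []
  | _, _, o => o.toList

/-- The statement and the internal state with which to continue. -/
def stmtNext (M : Λ → TM2.Stmt (fun _ : K' => Γ) Λ σ) :
    TM2.Stmt (fun _ : K' => Γ) Λ σ → σ → Option Γ → Option (TM2.Stmt (fun _ : K' => Γ) Λ σ) × σ
  | .push _ _ q, v, _ => (some q, v)
  | .peek _ f q, v, o => (some q, f v o)
  | .pop _ f q, v, o => (some q, f v o)
  | .load a q, v, _ => (some q, a v)
  | .branch f q₁ q₂, v, _ => (some (cond (f v) q₁ q₂), v)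
  | .goto l, v, _ => (some (M (l v)), v)
  | .halt, v, _ => (none, v)

/-- A machine with four stacks and several operations as a stack machine with one operation. -/
def ofTM2 (M : Λ → TM2.Stmt (fun _ : K' => Γ) Λ σ) :
    StackMachine Γ (Option (TM2.Stmt (fun _ : K' => Γ) Λ σ) × σ) where
  stk p := p.1.elim .main stmtStack
  out p o := p.1.elim [] fun q => stmtOut q p.2 o
  next p o := p.1.elim p fun q => stmtNext M q p.2 o
  halted := {p | p.1 = none}

variable {M : Λ → TM2.Stmt (fun _ : K' => Γ) Λ σ}

lemma ofTM2_step (q : TM2.Stmt (fun _ : K' => Γ) Λ σ) (v : σ) (S : K' → List Γ) :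
    (ofTM2 M).step ((some q, v), S) = some (stmtNext M q v (S (stmtStack q)).head?,
      Function.update S (stmtStack q)
        (stmtOut q v (S (stmtStack q)).head? ++ (S (stmtStack q)).tail)) := by
  simp [step, ofTM2]

/-- Each constructor of a statement costs one step. Those that touch no stack operate on `main` and
put its top symbol back. -/
lemma reaches_stepAux (q : TM2.Stmt (fun _ : K' => Γ) Λ σ) (v : σ) (S : K' → List Γ) :
    Reaches₁ (ofTM2 M).step ((some q, v), S)
      (((TM2.stepAux q v S).l.map M, (TM2.stepAux q v S).var), (TM2.stepAux q v S).stk) := by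
  have ht : ∀ l : List Γ, l.head?.toList ++ l.tail = l := fun l => by cases l <;> rfl
  induction q generalizing v S with
  | push k f q ih =>
    refine .head (b := ((some q, v), _)) (ofTM2_step ..) ?_
    simpa [Reaches₁, stmtOut, stmtStack, ht] using ih v (Function.update S k (f v :: S k))
  | peek k f q ih =>
    refine .head (b := ((some q, f v (S k).head?), _)) (ofTM2_step ..) ?_
    simpa [Reaches₁, stmtOut, stmtStack, ht] using ih (f v (S k).head?) S
  | pop k f q ih =>
    refine .head (b := ((some q, f v (S k).head?), _)) (ofTM2_step ..) ?_
    simpa [Reaches₁, stmtOut, stmtStack, ht] using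
      ih (f v (S k).head?) (Function.update S k (S k).tail)
  | load a q ih =>
    refine .head (b := ((some q, a v), _)) (ofTM2_step ..) ?_
    simpa [Reaches₁, stmtOut, stmtStack, ht] using ih (a v) S
  | branch f q₁ q₂ ih₁ ih₂ =>
    refine .head (b := ((some (cond (f v) q₁ q₂), v), _)) (ofTM2_step ..) ?_
    cases h : f v
    · simpa [Reaches₁, stmtOut, stmtStack, ht, h] using ih₂ v S
    · simpa [Reaches₁, stmtOut, stmtStack, ht, h] using ih₁ v S
  | goto l =>
    refine .single (show _ = _ from (ofTM2_step ..).trans ?_)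
    simp [stmtOut, stmtStack, stmtNext, ht]
  | halt =>
    refine .single (show _ = _ from (ofTM2_step ..).trans ?_)
    simp [stmtOut, stmtStack, stmtNext, ht]

lemma ofTM2_respects : Respects (TM2.step M) (ofTM2 M).step
    fun c c' => c' = ((c.l.map M, c.var), c.stk) := by
  rintro ⟨_ | l, v, S⟩ _ rfl
  · simp [step, ofTM2]
  · exact ⟨_, rfl, reaches_stepAux (M l) v S⟩

lemma some_mem_stmts {S : Finset Λ} {l : Λ} (h : l ∈ S) : some (M l) ∈ TM2.stmts M S := by
  simp only [TM2.stmts, Finset.some_mem_insertNone, Finset.mem_biUnion]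
  exact ⟨l, h, TM2.stmts₁_self⟩

/-- There are infinitely many statements, but only the finitely many substatements of supported ones
occur. This closure allows the restriction to finitely many states. -/
lemma stmtNext_mem {S : Finset Λ} (hS : ∀ l ∈ S, TM2.SupportsStmt S (M l))
    {q : TM2.Stmt (fun _ : K' => Γ) Λ σ} (hq : some q ∈ TM2.stmts M S) (v : σ) (o : Option Γ) :
    (stmtNext M q v o).1 ∈ TM2.stmts M S := by
  have h1 : ∀ {q'}, q' ∈ TM2.stmts₁ q → some q' ∈ TM2.stmts M S := fun h => TM2.stmts_trans h hq
  have hs : TM2.SupportsStmt S q := by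
    simp only [TM2.stmts, Finset.some_mem_insertNone, Finset.mem_biUnion] at hq
    obtain ⟨l, hl, h⟩ := hq
    exact TM2.stmts₁_supportsStmt_mono h (hS l hl)
  have h2 : ∀ q' : TM2.Stmt (fun _ : K' => Γ) Λ σ, q' ∈ TM2.stmts₁ q' := fun _ => TM2.stmts₁_self
  cases q with
  | push | peek | pop | load => exact h1 (by simp [TM2.stmts₁, h2])
  | branch f q₁ q₂ => exact h1 (by cases h : f v <;> simp [TM2.stmts₁, h2])
  | goto l =>
    exact some_mem_stmts (hs v)
  | halt => simp [stmtNext, TM2.stmts]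

/-- There is a stack machine with finitely many states whose halting problem is undecidable. -/
theorem exists_universal : ∃ (Λ : Type) (_ : Finite Λ) (M : StackMachine Γ' Λ) (q₀ : Λ)
    (D : ℕ → Prop), ¬ REPred (fun x => ¬ D x) ∧
      ∀ x, (eval M.step (q₀, K'.elim (trList [x]) [] [] [])).Dom ↔ D x := by
  let f : ℕ →. ℕ := fun x => (Denumerable.ofNat Nat.Partrec.Code x).eval 0
  have hf : Partrec f := Nat.Partrec.Code.eval_part.comp (Computable.ofNat _) (Computable.const 0)
  obtain ⟨c, hc⟩ := ToPartrec.Code.exists_code (Nat.Partrec'.part_iff₁.2 hf)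
  have hc' : ∀ x, c.eval [x] = pure <$> f x := fun x => hc ⟨[x], rfl⟩
  have hS := (tr_supports c Cont'.halt).2
  have h0 := (tr_supports c Cont'.halt).1
  let M : Λ' → TM2.Stmt (fun _ : K' => Γ') Λ' (Option Γ') := tr
  let P : Set (Option (TM2.Stmt (fun _ : K' => Γ') Λ' (Option Γ')) × Option Γ') :=
    {p | p.1 ∈ TM2.stmts M (codeSupp c Cont'.halt)}
  have hP : ∀ p ∈ P, ∀ o, (ofTM2 M).next p o ∈ P := by
    rintro ⟨_ | q, v⟩ hp o
    · exact hp
    · exact stmtNext_mem hS hp v o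
  have hfin : P.Finite := by
    have : Finite Γ' := Finite.of_fintype _
    exact ((TM2.stmts M _).finite_toSet.prod (Set.toFinite (Set.univ : Set (Option Γ')))).subset
      fun p hp => ⟨hp, trivial⟩
  have hq : (some (M (trNormal c Cont'.halt)), none) ∈ P := some_mem_stmts (M := M) h0
  refine ⟨P, hfin.to_subtype, (ofTM2 M).restrict P hP, ⟨_, hq⟩, fun x => (f x).Dom, ?_, fun x => ?_⟩
  · intro h
    refine ComputablePred.halting_problem_not_re 0 ?_
    refine (Partrec.comp h Computable.encode).of_eq fun c => ?_
    have : Denumerable.ofNat Nat.Partrec.Code (Encodable.encode c) = c := Denumerable.ofNat_encode c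
    simp only [f]
    rw [this]
  · refine (tr_eval_dom (restrict_respects (ofTM2 M) P hP)
      (a₁ := ((some (M (trNormal c Cont'.halt)), none), K'.elim (trList [x]) [] [] [])) rfl).trans
      ((tr_eval_dom (ofTM2_respects (M := M)) (a₁ := init c [x]) rfl).trans ?_)
    change (eval (TM2.step tr) _).Dom ↔ _
    rw [PartrecToTM2.tr_eval, hc']
    rfl

end StackMachine

/-! ### The encoding of the input is primitive recursive -/

/-- The successor of a number in binary notation, with the least significant digit first. -/
def binarySucc {A : Type} [DecidableEq A] (zero one : A) (l : List A) : List A :=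
  l.rec [one] fun x l ih => if x = one then zero :: ih else one :: l

lemma primrec_binarySucc {A : Type} [DecidableEq A] [Primcodable A] (zero one : A) :
    Primrec (binarySucc zero one) := by
  refine Primrec.list_rec (h := fun (_ : List A) p =>
      if p.1 = one then zero :: p.2.2 else one :: p.2.1)
    Primrec.id (Primrec.const _) ?_
  have h1 : Primrec fun a : List A × A × List A × List A => a.2.1 := Primrec.fst.comp Primrec.snd
  have h2 : Primrec fun a : List A × A × List A × List A => a.2.2 := Primrec.snd.comp Primrec.snd
  exact Primrec.ite (Primrec.eq.comp h1 (Primrec.const one))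
    (Primrec.list_cons.comp (Primrec.const zero) (Primrec.snd.comp h2))
    (Primrec.list_cons.comp (Primrec.const one) (Primrec.fst.comp h2))

open Turing.PartrecToTM2 in
lemma binarySucc_trNat {A : Type} [DecidableEq A] {f : Γ' → A} (hf : f .bit0 ≠ f .bit1) (x : ℕ) :
    binarySucc (f .bit0) (f .bit1) ((trNat x).map f) = (trNat (x + 1)).map f := by
  have key : ∀ p : PosNum, binarySucc (f .bit0) (f .bit1) ((trPosNum p).map f) =
      (trPosNum p.succ).map f := fun p => by
    induction p with
    | one => simp [binarySucc, trPosNum, PosNum.succ]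
    | bit1 p ih => simpa [binarySucc, trPosNum, PosNum.succ] using ih
    | bit0 p ih => simp [binarySucc, trPosNum, PosNum.succ, hf]
  simp only [trNat, Nat.cast_succ, Num.add_one, Num.succ]
  cases (x : Num) with
  | zero => rfl
  | pos p => exact key p

-- Iterating `binarySucc` from the empty word produces all encodings. The renaming `f` only has to
-- keep the two digits apart.
open Turing.PartrecToTM2 in
lemma primrec_map_trNat {A : Type} [DecidableEq A] [Primcodable A] {f : Γ' → A}
    (hf : f .bit0 ≠ f .bit1) : Primrec fun x => (trNat x).map f := by
  refine (Primrec.nat_iterate Primrec.id (Primrec.const []) ((primrec_binarySucc (f .bit0)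
    (f .bit1)).comp Primrec.snd).to₂).of_eq fun x => ?_
  induction x with
  | zero => simp
  | succ x ih =>
    rw [id, Function.iterate_succ_apply']
    rw [id] at ih
    rw [ih, binarySucc_trNat hf]

/-! ### A universal queue machine -/

namespace QueueMachine

open Turing.PartrecToTM2 StackMachine

/-- There is a queue machine that starts a counter if and only if a given input belongs to a set
with a complement that is not recursively enumerable. -/
theorem exists_universal : ∃ (n m : ℕ) (δ : QueueMachine (Fin n) (Fin m)) (b e : Fin n)
    (g q₀ : Fin m) (W : ℕ → List (Fin n)) (D : ℕ → Prop),
    Primrec W ∧ ¬ REPred (fun x => ¬ D x) ∧ IsCounter δ b e g ∧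
    (∀ x i, ¬ (run δ (W x) q₀ i).Stuck) ∧
    (∀ x, D x → ∃ i r, run δ (W x) q₀ i = ⟨[b, e], g, r, []⟩) ∧
    ∀ x, ¬ D x → ∀ i, (run δ (W x) q₀ i).state ≠ g := by
  obtain ⟨Λ, _, M, q₀, D, hD, hM⟩ := StackMachine.exists_universal
  have : Finite Γ' := Finite.of_fintype _
  obtain ⟨n, ⟨f⟩⟩ := Finite.exists_equiv_fin (Option Γ')
  obtain ⟨m, ⟨h⟩⟩ := Finite.exists_equiv_fin (QueueState Λ)
  let δ' := M.toQueue .bit0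
  let δ : QueueMachine (Fin n) (Fin m) := fun q x =>
    ((δ' (h.symm q) (f.symm x)).1.map f, h (δ' (h.symm q) (f.symm x)).2)
  have hδ : ∀ q x, δ (h q) (f x) = ((δ' q x).1.map f, h (δ' q x).2) := fun q x => by simp [δ]
  let W' : ℕ → List (Option Γ') := fun x => encodeStacks (K'.elim (trList [x]) [] [] [])
  have hrun := fun x i => run_map hδ (W' x) (M.passStart q₀) i
  have hc : IsCounter δ' (some .bit0) none .count := isCounter
  -- A stuck configuration never changes, so infinitely many moments at which the machine is not
  -- stuck suffice: marked moments of the counter, or beginnings of passes, when the queue contains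
  -- separators.
  have hstuck : ∀ x i, ¬ (run δ' (W' x) (M.passStart q₀) i).Stuck := fun x => by
    refine not_stuck fun n => ?_
    by_cases hx : (StateTransition.eval M.step (q₀, K'.elim (trList [x]) [] [] [])).Dom
    · obtain ⟨i, r, hr : run δ' (W' x) (M.passStart q₀) i = _⟩ :=
        exists_run_of_dom (b := .bit0) hx
      obtain ⟨j, hj, r', hr'⟩ := hc.exists_run hr n
      exact ⟨j, hj, by simp [hr', QueueCfg.Stuck]⟩
    · obtain ⟨j, hj, q, r, S, hr : run δ' (W' x) (M.passStart q₀) j = _⟩ :=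
        exists_run_of_not_dom (b := .bit0) hx n
      exact ⟨j, hj, by
        simp [hr, QueueCfg.Stuck, encodeStacks, encodeStack]⟩
  refine ⟨n, m, δ, f (some .bit0), f none, h .count, h (M.passStart q₀), fun x => (W' x).map f, D,
    ?_, hD, ⟨fun he => hc.ne (f.injective he), ?_, ?_, fun y => ?_⟩, fun x i hs => hstuck x i ?_,
    fun x hx => ?_, fun x hx i hi => ?_⟩
  · have h1 : Primrec fun x => (trNat x).map fun a => f (some a) :=
      primrec_map_trNat fun he => by simpa using f.injective he
    -- Only `main` is filled initially, with the digits of `x` and `cons`; all that follows the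
    -- digits is constant.
    refine (Primrec.list_append.comp h1 (Primrec.const
      [f (some .cons), f none, f none, f none, f none])).of_eq fun x => ?_
    simp [W', encodeStacks, encodeStack, trList]
  · rw [hδ, hc.copy]
    rfl
  · rw [hδ, hc.wrap]
    rfl
  · obtain ⟨y, rfl⟩ := f.surjective y
    rw [hδ, hc.stay]
  · simpa only [hrun, QueueCfg.map, QueueCfg.Stuck, List.map_eq_nil_iff] using hs
  · obtain ⟨i, r, hr : run δ' (W' x) (M.passStart q₀) i = _⟩ :=
        exists_run_of_dom (b := .bit0) ((hM x).2 hx)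
    refine ⟨i, r.map f, ?_⟩
    rw [hrun]
    rw [hr]
    rfl
  · rw [hrun] at hi
    obtain ⟨j, hj, q, r, S, hr : run δ' (W' x) (M.passStart q₀) j = _⟩ :=
        exists_run_of_not_dom (b := .bit0) (mt (hM x).1 hx) i
    -- The counting state would persist, but a later pass begins in a scanning state.
    have := state_of_le (δ := δ') (w := W' x) (q := M.passStart q₀) (g := .count)
      hc.stay hj (h.injective hi)
    simp [hr] at this

end QueueMachine

/-! ### Steps and halting of multihead automata -/

section TapeSymbols

variable {A : Type} {w : List A}

lemma tapeSymbol_succ {j : Fin (w.length + 2)} {i : ℕ} (h : (j : ℕ) = i + 1) :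
    tapeSymbol w j = (w[i]?).elim TapeSymbol.right Sum.inl := by
  unfold tapeSymbol
  rw [h]

lemma exists_legal_position {j : Fin (w.length + 2)} {d : ℤ} (h : LegalMove (tapeSymbol w j) d) :
    ∃ j' : Fin (w.length + 2), ((j' : ℕ) : ℤ) = ((j : ℕ) : ℤ) + d := by
  obtain ⟨h1, h2, h3⟩ := h
  have hj := j.isLt
  obtain rfl | rfl | rfl := h1
  · have : (j : ℕ) ≠ 0 := fun h0 => h2 (by unfold tapeSymbol; rw [h0]) rfl
    exact ⟨⟨j - 1, by omega⟩, by push_cast; omega⟩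
  · exact ⟨j, by simp⟩
  · have : (j : ℕ) ≠ w.length + 1 := fun h0 => h3 (by simp [tapeSymbol_succ h0]) rfl
    exact ⟨⟨j + 1, by omega⟩, by push_cast; omega⟩

end TapeSymbols

namespace MHFA

variable {k : ℕ} {A S : Type} {M : MHFA k A S} {w : List A}

lemma exists_step {c : Config k S w} (h : ¬ M.Halts w c) : ∃ c', M.Step w c c' := by
  obtain ⟨⟨s, d⟩, hd⟩ := Set.nonempty_iff_ne_empty.2 h
  choose p hp using fun i => exists_legal_position (M.legal _ _ _ hd i)
  exact ⟨(s, p), d, hd, hp⟩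

lemma IsDeterministic.step_unique (hM : M.IsDeterministic) {c c₁ c₂ : Config k S w}
    (h₁ : M.Step w c c₁) (h₂ : M.Step w c c₂) : c₁ = c₂ := by
  obtain ⟨d₁, h₁, hp₁⟩ := h₁
  obtain ⟨d₂, h₂, hp₂⟩ := h₂
  have h := hM _ _ h₁ h₂
  simp only [Prod.mk.injEq] at h
  obtain ⟨h, rfl⟩ := h
  refine Prod.ext h (funext fun i => Fin.ext ?_)
  have := hp₁ i
  have := hp₂ i
  omega

lemma not_step_of_halts {c c' : Config k S w} (h : M.Halts w c) : ¬ M.Step w c c' := by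
  rintro ⟨d, hd, -⟩
  rw [h] at hd
  exact hd

lemma IsDeterministic.eq_of_halts (hM : M.IsDeterministic) {c c₁ c₂ : Config k S w}
    (h₁ : Relation.ReflTransGen (M.Step w) c c₁) (h₂ : Relation.ReflTransGen (M.Step w) c c₂)
    (hc₁ : M.Halts w c₁) (hc₂ : M.Halts w c₂) : c₁ = c₂ := by
  have hu : Relator.RightUnique (M.Step w) := fun _ _ _ h h' => hM.step_unique h h'
  obtain h | h := Relation.ReflTransGen.total_of_right_unique hu h₁ h₂
  · obtain h | ⟨c', h, -⟩ := h.cases_head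
    · exact h
    · exact (not_step_of_halts hc₁ h).elim
  · obtain h | ⟨c', h, -⟩ := h.cases_head
    · exact h.symm
    · exact (not_step_of_halts hc₂ h).elim

/-- If all steps increase a bounded quantity, then some computation halts. -/
lemma exists_halts {B : ℕ} (f : Config k S w → ℕ) (hB : ∀ c, f c ≤ B)
    (hf : ∀ c c', M.Step w c c' → f c < f c') (c : Config k S w) :
    ∃ c', Relation.ReflTransGen (M.Step w) c c' ∧ M.Halts w c' := by
  by_cases h : M.Halts w c
  · exact ⟨c, .refl, h⟩
  · obtain ⟨c₁, h₁⟩ := exists_step h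
    have := hf c c₁ h₁
    have := hB c₁
    obtain ⟨c', hc', hh⟩ := exists_halts f hB hf c₁
    exact ⟨c', .head h₁ hc', hh⟩
termination_by B - f c

/-- Complementation of the set of accepting states complements the language of a deterministic
automaton that always halts. -/
lemma IsDeterministic.mem_language_compl (hM : M.IsDeterministic)
    (hh : ∃ c, Relation.ReflTransGen (M.Step w) (M.init w) c ∧ M.Halts w c) :
    w ∈ ({ M with accept := M.acceptᶜ } : MHFA k A S).language ↔ w ∉ M.language := by
  constructor
  · rintro ⟨c, h1, h2, h3⟩ ⟨c', h1', h2', h3'⟩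
    obtain rfl := hM.eq_of_halts h1 h1' h3 h3'
    exact h2 h2'
  · intro h
    obtain ⟨c, h1, h2⟩ := hh
    exact ⟨c, h1, fun h3 => h ⟨c, h1, h3, h2⟩, h2⟩

end MHFA

/-! ### Automata that check runs of queue machines -/

namespace QueueMachine

variable {n m k : ℕ}

/-- The number of the state of an automaton that is to check that a word is appended to the queue
before a queue machine goes on in a given state. -/
def stateCode (p : List (Fin n) × Fin m) : ℕ := Encodable.encode p + 1

lemma stateCode_injective : Function.Injective (stateCode : List (Fin n) × Fin m → ℕ) :=
  fun _ _ h => Encodable.encode_injective (Nat.succ_injective h)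

/-- Only the head `i` is moved, by one square to the right. -/
def moveHead (i : Fin k) : Fin k → ℤ := Pi.single i 1

/-- The transition of an automaton that checks a run of a queue machine: the head `i₀` reads the
first letter of the queue, and the head `i₁` checks the letter that is appended. The state `0` is
entered when this letter is wrong. -/
def target (δ : QueueMachine (Fin n) (Fin m)) (i₀ i₁ : Fin k) (p : List (Fin n) × Fin m)
    (a : Fin k → TapeSymbol (Fin n)) : Option (ℕ × (Fin k → ℤ)) :=
  match p, a i₀, a i₁ with
  | ([], q), Sum.inl x, _ => some (stateCode (δ q x), moveHead i₀)
  | (y :: l, q), _, Sum.inl x =>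
    some (if x = y then (stateCode (l, q), moveHead i₁) else (0, fun _ => 0))
  | _, _, _ => none

/-- The transitions from given states, as a list. -/
noncomputable def transitions (δ : QueueMachine (Fin n) (Fin m)) (i₀ i₁ : Fin k)
    (P : List (List (Fin n) × Fin m)) :
    List ((ℕ × (Fin k → TapeSymbol ℕ)) × (ℕ × (Fin k → ℤ))) :=
  P.flatMap fun p => (Finset.univ : Finset (Fin k → TapeSymbol (Fin n))).toList.filterMap fun a =>
    (target δ i₀ i₁ p a).map fun t => ((stateCode p, fun i => Sum.map Fin.val id (a i)), t)

/-- The pairs of a suffix of a word and a state. -/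
def suffixes (w : List (Fin n)) (q : Fin m) : List (List (Fin n) × Fin m) :=
  (List.range (w.length + 1)).map fun i => (w.drop i, q)

/-- All pairs of a pending word and a state that occur in runs from a given pair. -/
noncomputable def pendings (δ : QueueMachine (Fin n) (Fin m)) (w : List (Fin n)) (q : Fin m) :
    List (List (Fin n) × Fin m) :=
  suffixes w q ++ (Finset.univ : Finset (Fin m × Fin n)).toList.flatMap fun p =>
    suffixes (δ p.1 p.2).1 (δ p.1 p.2).2

/-- A number that bounds the numbers of given states. -/
def stateBound (P : List (List (Fin n) × Fin m)) : ℕ := (P.map stateCode).sum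

/-- An automaton that checks the run of a queue machine from the state `q` with pending word `w`. -/
noncomputable def toCode (δ : QueueMachine (Fin n) (Fin m)) (i₀ i₁ : Fin k) (w : List (Fin n))
    (q : Fin m) (F : List ℕ) : MHFACode k :=
  (stateBound (pendings δ w q), stateCode (w, q), F, transitions δ i₀ i₁ (pendings δ w q))

variable {δ : QueueMachine (Fin n) (Fin m)} {i₀ i₁ : Fin k}

lemma mem_suffixes {w l : List (Fin n)} {q q' : Fin m} :
    (l, q') ∈ suffixes w q ↔ l <:+ w ∧ q' = q := by
  simp only [suffixes, List.mem_map, List.mem_range, Prod.mk.injEq]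
  constructor
  · rintro ⟨i, -, rfl, rfl⟩
    exact ⟨List.drop_suffix i w, rfl⟩
  · rintro ⟨⟨t, rfl⟩, rfl⟩
    exact ⟨t.length, by simp, by simp, rfl⟩

lemma mem_pendings {w l : List (Fin n)} {q q' : Fin m} :
    (l, q') ∈ pendings δ w q ↔ (l <:+ w ∧ q' = q) ∨ ∃ p x, l <:+ (δ p x).1 ∧ q' = (δ p x).2 := by
  simp [pendings, mem_suffixes]

lemma run_mem_pendings {w : List (Fin n)} {q : Fin m} (i : ℕ) :
    ((run δ w q i).pend, (run δ w q i).state) ∈ pendings δ w q := by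
  induction i with
  | zero => exact mem_pendings.2 (.inl ⟨List.suffix_rfl, rfl⟩)
  | succ i ih =>
    rw [run_succ]
    generalize run δ w q i = c at ih
    obtain ⟨_ | ⟨x, l⟩, p, r, _ | ⟨y, u⟩⟩ := c
    · exact ih
    · exact mem_pendings.2 (.inr ⟨p, y, List.suffix_rfl, rfl⟩)
    all_goals
      refine mem_pendings.2 ((mem_pendings.1 ih).imp (fun h => ?_) ?_)
      · exact ⟨(List.suffix_cons x l).trans h.1, h.2⟩
      · rintro ⟨p', x', h⟩
        exact ⟨p', x', (List.suffix_cons x l).trans h.1, h.2⟩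

lemma stateCode_le {P : List (List (Fin n) × Fin m)} {p : List (Fin n) × Fin m} (h : p ∈ P) :
    stateCode p ≤ stateBound P :=
  List.single_le_sum (fun _ _ => Nat.zero_le _) _ (List.mem_map_of_mem h)

/-- The head moves of a transition. -/
lemma target_eq_some {p : List (Fin n) × Fin m} {a : Fin k → TapeSymbol (Fin n)}
    {t : ℕ × (Fin k → ℤ)} (h : target δ i₀ i₁ p a = some t) :
    (∃ x, a i₀ = Sum.inl x ∧ t.2 = moveHead i₀) ∨ (∃ x, a i₁ = Sum.inl x ∧ t.2 = moveHead i₁) ∨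
      t = (0, fun _ => 0) := by
  unfold target at h
  split at h
  · rename_i x hx
    exact .inl ⟨x, hx, by simp_all [← Option.some_injective _ h]⟩
  · rename_i x hx
    split_ifs at h
    · exact .inr (.inl ⟨x, hx, by simp [← Option.some_injective _ h]⟩)
    · exact .inr (.inr (Option.some_injective _ h).symm)
  · simp at h

lemma legalMove_zero {A : Type} (a : TapeSymbol A) : LegalMove a 0 := by simp [LegalMove]

lemma legalMove_moveHead {a : Fin k → TapeSymbol (Fin n)} {i : Fin k} {x : Fin n}
    (h : a i = Sum.inl x) (j : Fin k) : LegalMove (a j) (moveHead i j) := by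
  by_cases hj : j = i
  · subst hj
    simp [LegalMove, moveHead, h]
  · simpa [moveHead, hj] using legalMove_zero _

lemma legalMove_of_target {p : List (Fin n) × Fin m} {a : Fin k → TapeSymbol (Fin n)}
    {t : ℕ × (Fin k → ℤ)} (h : target δ i₀ i₁ p a = some t) (i : Fin k) :
    LegalMove (a i) (t.2 i) := by
  obtain ⟨x, hx, ht⟩ | ⟨x, hx, ht⟩ | rfl := target_eq_some h
  · rw [ht]
    exact legalMove_moveHead hx i
  · rw [ht]
    exact legalMove_moveHead hx i
  · exact legalMove_zero _

section Automaton

variable {w : List (Fin n)} {q : Fin m} {F : List ℕ}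

lemma mem_toMHFA_δ {s : Fin (stateBound (pendings δ w q) + 1)} {a : Fin k → TapeSymbol (Fin n)}
    {t : Fin (stateBound (pendings δ w q) + 1) × (Fin k → ℤ)} :
    t ∈ ((toCode δ i₀ i₁ w q F).toMHFA n).δ s a ↔ ∃ p ∈ pendings δ w q, stateCode p = s ∧
      target δ i₀ i₁ p a = some ((t.1 : ℕ), t.2) := by
  have hinj : ∀ a' : Fin k → TapeSymbol (Fin n), (fun i => Sum.map Fin.val id (a' i)) =
      (fun i => Sum.map Fin.val id (a i)) → a' = a := fun a' h => funext fun i =>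
    Sum.map_injective.2 ⟨Fin.val_injective, Function.injective_id⟩ (congrFun h i)
  constructor
  · rintro ⟨h, -⟩
    simp only [toCode, transitions, List.mem_flatMap, List.mem_filterMap, Option.map_eq_some_iff,
      Prod.mk.injEq] at h
    obtain ⟨p, hp, a', -, t', ht, ⟨hs, ha⟩, rfl⟩ := h
    exact ⟨p, hp, hs, hinj a' ha ▸ ht⟩
  · rintro ⟨p, hp, hs, ht⟩
    refine ⟨?_, legalMove_of_target ht⟩
    simp only [toCode, transitions, List.mem_flatMap, List.mem_filterMap, Option.map_eq_some_iff,
      Prod.mk.injEq]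
    exact ⟨p, hp, a, by simp, _, ht, ⟨hs, rfl⟩, rfl⟩

lemma toMHFA_isDeterministic : ((toCode δ i₀ i₁ w q F).toMHFA n).IsDeterministic := by
  intro s a t ht t' ht'
  obtain ⟨p, -, hs, ht⟩ := mem_toMHFA_δ.1 ht
  obtain ⟨p', -, hs', ht'⟩ := mem_toMHFA_δ.1 ht'
  obtain rfl := stateCode_injective (hs.trans hs'.symm)
  simp only [ht, Option.some.injEq, Prod.mk.injEq] at ht'
  exact Prod.ext (Fin.ext ht'.1) ht'.2

lemma toMHFA_isOneWay : ((toCode δ i₀ i₁ w q F).toMHFA n).IsOneWay := by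
  intro s a t ht i
  obtain ⟨p, -, hs, ht⟩ := mem_toMHFA_δ.1 ht
  have hm : ∀ j : Fin k, moveHead j i ≠ -1 := fun j => by
    by_cases hj : i = j
    · simp [moveHead, hj]
    · simp [moveHead, hj]
  obtain ⟨-, -, h⟩ | ⟨-, -, h⟩ | h := target_eq_some ht
  · exact h ▸ hm _
  · exact h ▸ hm _
  · simp only [Prod.mk.injEq] at h
    simp [h.2]

lemma toMHFA_hasType (t : HeadType) : ((toCode δ i₀ i₁ w q F).toMHFA n).HasType t := by
  cases t
  exacts [⟨toMHFA_isOneWay, toMHFA_isDeterministic⟩, toMHFA_isOneWay, toMHFA_isDeterministic,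
    trivial]

/-- A configuration of the automaton corresponds to a configuration of the queue machine. -/
structure Corresponds (δ : QueueMachine (Fin n) (Fin m)) (i₀ i₁ : Fin k) {w : List (Fin n)}
    {q : Fin m} {v : List (Fin n)} (c : MHFA.Config k (Fin (stateBound (pendings δ w q) + 1)) v)
    (R : QueueCfg (Fin n) (Fin m)) : Prop where
  state : (c.1 : ℕ) = stateCode (R.pend, R.state)
  head₀ : (c.2 i₀ : ℕ) = R.read.length + 1
  head₁ : (c.2 i₁ : ℕ) = R.history.length + 1
  isPrefix : R.history <+: v

variable {v : List (Fin n)} {c c' : MHFA.Config k (Fin (stateBound (pendings δ w q) + 1)) v}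
  {R : QueueCfg (Fin n) (Fin m)}

lemma Corresponds.scanned₀ {r u : List (Fin n)} {q' : Fin m} {x : Fin n}
    (h : Corresponds δ i₀ i₁ c ⟨[], q', r, x :: u⟩) : MHFA.scanned c i₀ = Sum.inl x := by
  have hv : v[r.length]? = some x := by
    obtain ⟨t, ht⟩ := h.isPrefix
    rw [← ht]
    simp [QueueCfg.history]
  rw [MHFA.scanned, tapeSymbol_succ h.head₀, hv]
  rfl

lemma Corresponds.scanned₁ (h : Corresponds δ i₀ i₁ c R) :
    (MHFA.scanned c i₁ = TapeSymbol.right ∧ R.history = v) ∨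
      ∃ x, MHFA.scanned c i₁ = Sum.inl x ∧ R.history ++ [x] <+: v := by
  obtain ⟨t, ht⟩ := h.isPrefix
  have hv : v[R.history.length]? = t.head? := by
    rw [← ht]
    cases t <;> simp
  rw [MHFA.scanned, tapeSymbol_succ h.head₁, hv]
  obtain _ | ⟨x, t⟩ := t
  · exact .inl ⟨rfl, by simpa using ht⟩
  · exact .inr ⟨x, rfl, t, by simpa using ht⟩

lemma target_of_step (hc : (c.1 : ℕ) = stateCode (R.pend, R.state))
    (hs : ((toCode δ i₀ i₁ w q F).toMHFA n).Step v c c') :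
    ∃ d, target δ i₀ i₁ (R.pend, R.state) (MHFA.scanned c) = some ((c'.1 : ℕ), d) ∧
      ∀ i, ((c'.2 i : ℕ) : ℤ) = ((c.2 i : ℕ) : ℤ) + d i := by
  obtain ⟨d, hd, hp⟩ := hs
  obtain ⟨p, -, hs, ht⟩ := mem_toMHFA_δ.1 hd
  obtain rfl := stateCode_injective (hs.trans hc)
  exact ⟨d, ht, hp⟩

/-- When a letter is read, `isPrefix` guarantees that `i₀` scans the true first letter of the queue.
When a letter is written, agreement with the tape extends the prefix, and disagreement excludes the
new history as a prefix of `v`. -/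
lemma Corresponds.step (hi : i₀ ≠ i₁) (h : Corresponds δ i₀ i₁ c R) (hR : ¬ R.Stuck)
    (hs : ((toCode δ i₀ i₁ w q F).toMHFA n).Step v c c') :
    Corresponds δ i₀ i₁ c' (step δ R) ∨
      ((c'.1 : ℕ) = 0 ∧ ¬ (QueueMachine.step δ R).history <+: v) := by
  obtain ⟨d, ht, hp⟩ := target_of_step h.state hs
  have hp₀ := hp i₀
  have hp₁ := hp i₁
  have h₀ := h.head₀
  have h₁ := h.head₁
  have hpre := h.isPrefix
  obtain ⟨_ | ⟨y, l⟩, q', r, u⟩ := R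
  · obtain _ | ⟨x, u⟩ := u
    · exact (hR ⟨rfl, rfl⟩).elim
    simp only [target, h.scanned₀, Option.some.injEq, Prod.mk.injEq] at ht
    obtain ⟨ht, rfl⟩ := ht
    simp only [moveHead, Pi.single_eq_same, Pi.single_eq_of_ne hi.symm] at hp₀ hp₁
    refine .inl ⟨ht.symm, ?_, ?_, ?_⟩
    · simp [QueueMachine.step] at h₀ ⊢
      omega
    · simp [QueueMachine.step, QueueCfg.history] at h₁ ⊢
      omega
    · simpa [QueueMachine.step, QueueCfg.history] using hpre
  · obtain ⟨hsc, -⟩ | ⟨x, hsc, hpre⟩ := h.scanned₁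
    · simp [target, hsc] at ht
    by_cases hxy : x = y
    · subst hxy
      simp only [target, hsc, if_true, Option.some.injEq, Prod.mk.injEq] at ht
      obtain ⟨ht, rfl⟩ := ht
      simp only [moveHead, Pi.single_eq_same, Pi.single_eq_of_ne hi] at hp₀ hp₁
      refine .inl ⟨ht.symm, ?_, ?_, ?_⟩
      · simp [QueueMachine.step] at h₀ ⊢
        omega
      · simp [QueueMachine.step, QueueCfg.history] at h₁ ⊢
        omega
      · simpa [QueueMachine.step, QueueCfg.history] using hpre
    · simp only [target, hsc, hxy, if_false, Option.some.injEq, Prod.mk.injEq] at ht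
      refine .inr ⟨ht.1.symm, fun hpre' => hxy ?_⟩
      have := (List.prefix_of_prefix_length_le hpre hpre'
        (by simp [QueueMachine.step, QueueCfg.history])).eq_of_length
        (by simp [QueueMachine.step, QueueCfg.history])
      simpa [QueueMachine.step, QueueCfg.history] using this

/-- With nothing pending, the queue is nonempty and its first letter is on the tape, so the
automaton goes on. Otherwise it stops only when `i₁` scans the right endmarker, that is, when the
history exhausts `v`. -/
lemma Corresponds.halts_iff (h : Corresponds δ i₀ i₁ c R) (hR : ¬ R.Stuck)
    (hp : (R.pend, R.state) ∈ pendings δ w q) :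
    ((toCode δ i₀ i₁ w q F).toMHFA n).Halts v c ↔ R.pend ≠ [] ∧ R.history = v := by
  have key : ((toCode δ i₀ i₁ w q F).toMHFA n).Halts v c ↔
      target δ i₀ i₁ (R.pend, R.state) (MHFA.scanned c) = none := by
    constructor
    · intro hh
      by_contra hn
      obtain ⟨⟨s, d⟩, ht⟩ := Option.ne_none_iff_exists'.1 hn
      -- Transitions to numbers beyond the bound would be ignored; `pendings` is closed under the
      -- moves of the queue machine, so none occurs here.
      have hs : s < stateBound (pendings δ w q) + 1 := by
        unfold target at ht
        split at ht
        · obtain rfl := (Prod.mk.inj (Option.some_injective _ ht)).1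
          exact Nat.lt_succ_of_le (stateCode_le (mem_pendings.2 (.inr ⟨_, _, List.suffix_rfl, rfl⟩)))
        · rename_i y l q' x hpe _
          have := Option.some_injective _ ht
          split_ifs at this
          · obtain rfl := (Prod.mk.inj this).1
            rw [hpe] at hp
            refine Nat.lt_succ_of_le (stateCode_le (mem_pendings.2
              ((mem_pendings.1 hp).imp (fun h => ?_) ?_)))
            · exact ⟨(List.suffix_cons y l).trans h.1, h.2⟩
            · rintro ⟨p', x', h⟩
              exact ⟨p', x', (List.suffix_cons y l).trans h.1, h.2⟩
          · obtain rfl := (Prod.mk.inj this).1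
            omega
        · simp at ht
      have : ((⟨s, hs⟩, d) : _ × _) ∈ ((toCode δ i₀ i₁ w q F).toMHFA n).δ c.1 (MHFA.scanned c) :=
        mem_toMHFA_δ.2 ⟨_, hp, h.state.symm, ht⟩
      exact Set.eq_empty_iff_forall_notMem.1 hh _ this
    · intro hn
      refine Set.eq_empty_of_forall_notMem fun t ht => ?_
      obtain ⟨p, -, hs, ht⟩ := mem_toMHFA_δ.1 ht
      obtain rfl := stateCode_injective (hs.trans h.state)
      exact Option.some_ne_none _ (ht.symm.trans hn)
  rw [key]
  obtain ⟨_ | ⟨y, l⟩, q', r, u⟩ := R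
  · obtain _ | ⟨x, u⟩ := u
    · exact (hR ⟨rfl, rfl⟩).elim
    simp [target, h.scanned₀]
  · obtain ⟨hsc, hv⟩ | ⟨x, hsc, hpre⟩ := h.scanned₁
    · simp [target, hsc, hv]
    · have hv : QueueCfg.history ⟨y :: l, q', r, u⟩ ≠ v := fun hv => by
        have := hpre.length_le
        simp [hv] at this
      simp [target, hsc, hv]

lemma corresponds_init (v : List (Fin n)) : Corresponds δ i₀ i₁
    (((toCode δ i₀ i₁ w q F).toMHFA n).init v) (run δ w q 0) where
  state := Nat.mod_eq_of_lt (Nat.lt_succ_of_le (stateCode_le (run_mem_pendings 0)))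
  head₀ := rfl
  head₁ := rfl
  isPrefix := List.nil_prefix

lemma exists_corresponds_of_reaches (hi : i₀ ≠ i₁) (hR : ∀ i, ¬ (run δ w q i).Stuck)
    (h : Relation.ReflTransGen (((toCode δ i₀ i₁ w q F).toMHFA n).Step v)
      (((toCode δ i₀ i₁ w q F).toMHFA n).init v) c) :
    (c.1 : ℕ) = 0 ∨ ∃ i, Corresponds δ i₀ i₁ c (run δ w q i) := by
  induction h with
  | refl => exact .inr ⟨0, corresponds_init v⟩
  | tail _ hs ih =>
    obtain h0 | ⟨i, h⟩ := ih
    · obtain ⟨d, hd, -⟩ := hs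
      obtain ⟨p, -, hp, -⟩ := mem_toMHFA_δ.1 hd
      rw [h0] at hp
      exact absurd hp (Nat.succ_ne_zero _)
    · obtain h | h := h.step hi (hR i) hs
      · exact .inr ⟨i + 1, (run_succ (δ := δ) w q i).symm ▸ h⟩
      · exact .inl h.1

lemma exists_reaches_corresponds (hi : i₀ ≠ i₁) (hR : ∀ i, ¬ (run δ w q i).Stuck) {i : ℕ}
    (h : (run δ w q i).history <+: v) : ∃ c, Corresponds δ i₀ i₁ c (run δ w q i) ∧
      Relation.ReflTransGen (((toCode δ i₀ i₁ w q F).toMHFA n).Step v)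
        (((toCode δ i₀ i₁ w q F).toMHFA n).init v) c := by
  induction i with
  | zero => exact ⟨_, corresponds_init v, .refl⟩
  | succ i ih =>
    obtain ⟨c, hc, hr⟩ := ih ((history_prefix_run (Nat.le_succ i)).trans h)
    rw [run_succ] at h ⊢
    have hn : ¬ ((toCode δ i₀ i₁ w q F).toMHFA n).Halts v c := by
      rw [hc.halts_iff (hR i) (run_mem_pendings i)]
      -- Halting would mean that the whole tape is checked while a letter is pending, but the next
      -- history is longer and still a prefix of the tape.
      rintro ⟨h1, rfl⟩
      have := h.length_le
      generalize run δ w q i = R at h1 this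
      obtain ⟨_ | ⟨y, l⟩, q', r, u⟩ := R
      · exact h1 rfl
      · simp [QueueMachine.step, QueueCfg.history] at this
    obtain ⟨c', hs⟩ := MHFA.exists_step hn
    obtain h' | h' := hc.step hi (hR i) hs
    · exact ⟨c', h', hr.tail hs⟩
    · exact (h'.2 h).elim

/-- The language of the automaton that checks the run of a queue machine. -/
theorem toCode_lang (hi : i₀ ≠ i₁) (hR : ∀ i, ¬ (run δ w q i).Stuck)
    {T : Set (List (Fin n) × Fin m)}
    (hT : ∀ p ∈ T, p.1 ≠ []) (h0 : 0 ∉ F) (hF : ∀ p ∈ pendings δ w q, stateCode p ∈ F ↔ p ∈ T) :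
    (toCode δ i₀ i₁ w q F).lang n = histories δ w q T := by
  ext v
  constructor
  · rintro ⟨c, h1, h2, h3⟩
    replace h2 : (c.1 : ℕ) ∈ F := h2
    obtain h | ⟨i, h⟩ := exists_corresponds_of_reaches hi hR h1
    · exact (h0 (h ▸ h2)).elim
    · rw [h.state, hF _ (run_mem_pendings i)] at h2
      exact ⟨i, h2, ((h.halts_iff (hR i) (run_mem_pendings i)).1 h3).2⟩
  · rintro ⟨i, hiT, rfl⟩
    obtain ⟨c, h, hr⟩ := exists_reaches_corresponds (F := F) hi hR (List.prefix_refl _)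
    refine ⟨c, hr, ?_, (h.halts_iff (hR i) (run_mem_pendings i)).2 ⟨hT _ hiT, rfl⟩⟩
    change (c.1 : ℕ) ∈ F
    rw [h.state]
    exact (hF _ (run_mem_pendings i)).2 hiT

/-- Each step moves one of the two heads to the right or enters the state `0`, which is never left.
So the sum of their positions, plus one in state `0`, increases. -/
lemma toMHFA_exists_halts (v : List (Fin n)) :
    ∃ c, Relation.ReflTransGen (((toCode δ i₀ i₁ w q F).toMHFA n).Step v)
        (((toCode δ i₀ i₁ w q F).toMHFA n).init v) c ∧
      ((toCode δ i₀ i₁ w q F).toMHFA n).Halts v c := by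
  refine MHFA.exists_halts (B := 2 * v.length + 3)
    (fun c : MHFA.Config k (Fin (stateBound (pendings δ w q) + 1)) v =>
      (c.2 i₀ : ℕ) + (c.2 i₁ : ℕ) + if (c.1 : ℕ) = 0 then 1 else 0) (fun c => ?_)
    (fun c c' hs => ?_) _
  · have := (c.2 i₀).isLt
    have := (c.2 i₁).isLt
    split_ifs <;> omega
  · obtain ⟨d, hd, hp⟩ := hs
    obtain ⟨p, -, hc, ht⟩ := mem_toMHFA_δ.1 hd
    have hp₀ := hp i₀
    have hp₁ := hp i₁
    have hc0 : (c.1 : ℕ) ≠ 0 := hc ▸ Nat.succ_ne_zero _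
    have hm : ∀ i j : Fin k, 0 ≤ moveHead i j := fun i j => by
      by_cases hj : j = i
      · simp [moveHead, hj]
      · simp [moveHead, hj]
    have hm' : ∀ i : Fin k, moveHead i i = 1 := fun i => by simp [moveHead]
    simp only [if_neg hc0]
    obtain ⟨-, -, h⟩ | ⟨-, -, h⟩ | h := target_eq_some ht
    · simp only at h
      rw [h] at hp₀ hp₁
      have := hm i₀ i₁
      have := hm' i₀
      omega
    · simp only at h
      rw [h] at hp₀ hp₁
      have := hm i₁ i₀
      have := hm' i₁
      omega
    · simp only [Prod.mk.injEq] at h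
      obtain ⟨h1, rfl⟩ := h
      simp only [add_zero] at hp₀ hp₁
      rw [if_pos h1]
      omega

/-- The automaton with complementary accepting states accepts the complement. -/
theorem mem_toCode_lang_compl (v : List (Fin n)) :
    v ∈ (toCode δ i₀ i₁ w q ((List.range (stateBound (pendings δ w q) + 1)).filter
      fun s => s ∉ F)).lang n ↔ v ∉ (toCode δ i₀ i₁ w q F).lang n := by
  have := (toMHFA_isDeterministic (F := F)).mem_language_compl
    (toMHFA_exists_halts (δ := δ) (i₀ := i₀) (i₁ := i₁) (w := w) (q := q) v)
  rw [MHFACode.lang, MHFACode.lang, ← this]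
  refine iff_of_eq (congrArg (fun M : MHFA k (Fin n) (Fin (stateBound (pendings δ w q) + 1)) =>
    v ∈ M.language) ?_)
  unfold MHFACode.toMHFA toCode
  congr 1
  ext s
  simpa using fun _ => Nat.le_of_lt_succ s.isLt

end Automaton

/-! ### The automata are computable from the input -/

section Primrec

lemma primrec_stateCode : Primrec (stateCode : List (Fin n) × Fin m → ℕ) :=
  Primrec.succ.comp Primrec.encode

/-- Only the pending word ranges over an infinite type, and only its first letter is inspected; the
rest is a function on a finite type. -/
lemma primrec_target (δ : QueueMachine (Fin n) (Fin m)) (i₀ i₁ : Fin k) :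
    Primrec₂ (target δ i₀ i₁) := by
  let X := (List (Fin n) × Fin m) × (Fin k → TapeSymbol (Fin n))
  let f : Fin m × (Fin k → TapeSymbol (Fin n)) → Option (ℕ × (Fin k → ℤ)) := fun x =>
    target δ i₀ i₁ ([], x.1) x.2
  let g : Fin n × (Fin k → TapeSymbol (Fin n)) → Option Bool := fun x =>
    (x.2 i₁).elim (fun y => some (y = x.1)) fun _ => none
  have hf : Primrec fun x : X => f (x.1.2, x.2) :=
    (Primrec.dom_finite f).comp (.pair (Primrec.snd.comp .fst) .snd)
  have hg : Primrec₂ fun (x : X) (y : Fin n × List (Fin n)) => (g (y.1, x.2)).map fun r =>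
      cond r (stateCode (y.2, x.1.2), moveHead i₁) (0, fun _ => 0) := by
    refine Primrec.option_map ((Primrec.dom_finite g).comp
      (.pair (Primrec.fst.comp .snd) (Primrec.snd.comp .fst)))
      (Primrec.cond .snd (.pair (primrec_stateCode.comp
        (.pair (Primrec.snd.comp (Primrec.snd.comp .fst))
          (Primrec.snd.comp (Primrec.fst.comp (Primrec.fst.comp .fst))))) (.const _)) (.const _))
  refine (Primrec.list_casesOn (Primrec.fst.comp .fst) hf hg).of_eq ?_
  rintro ⟨⟨_ | ⟨y, l⟩, q⟩, a⟩
  · rfl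
  · simp only [g, target]
    rcases a i₁ with x | x
    · by_cases h : x = y <;> simp [h]
    · rfl

lemma primrec_transitions (δ : QueueMachine (Fin n) (Fin m)) (i₀ i₁ : Fin k) :
    Primrec (transitions δ i₀ i₁) := by
  refine Primrec.list_flatMap .id (Primrec.listFilterMap (.const _) ?_)
  refine Primrec.option_map ((primrec_target δ i₀ i₁).comp (Primrec.snd.comp .fst) .snd) ?_
  have : Primrec fun a : Fin k → TapeSymbol (Fin n) =>
      (fun i => Sum.map Fin.val id (a i) : Fin k → TapeSymbol ℕ) := Primrec.dom_finite _
  exact Primrec.pair (.pair (primrec_stateCode.comp (Primrec.snd.comp (Primrec.fst.comp .fst)))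
    (this.comp (Primrec.snd.comp .fst))) .snd

lemma primrec_pendings (δ : QueueMachine (Fin n) (Fin m)) (q : Fin m) :
    Primrec fun w => pendings δ w q := by
  refine Primrec.list_append.comp (Primrec.list_map (Primrec.list_range.comp
    (Primrec.succ.comp Primrec.list_length)) ?_) (.const _)
  exact Primrec.pair (Primrec.list_drop.comp .snd .fst) (.const _)

lemma primrec_stateBound : Primrec (stateBound : List (List (Fin n) × Fin m) → ℕ) :=
  (Primrec.list_foldr (h := fun _ x => x.1 + x.2) (Primrec.list_map .id
    (primrec_stateCode.comp .snd).to₂) (.const 0)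
    (Primrec.nat_add.comp (Primrec.fst.comp .snd) (Primrec.snd.comp .snd))).of_eq fun _ => rfl

lemma primrec_toCode (δ : QueueMachine (Fin n) (Fin m)) (i₀ i₁ : Fin k) (q : Fin m)
    {F : List (Fin n) → List ℕ} (hF : Primrec F) :
    Primrec fun w => toCode δ i₀ i₁ w q (F w) :=
  .pair (primrec_stateBound.comp (primrec_pendings δ q)) (.pair (primrec_stateCode.comp
    (.pair .id (.const q))) (.pair hF ((primrec_transitions δ i₀ i₁).comp (primrec_pendings δ q))))

end Primrec

end QueueMachine

/-! ### The reductions -/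

lemma not_semiDecidableProblem {α : Type} [Primcodable α] {I Q : α → Prop} {D : ℕ → Prop}
    (hD : ¬ REPred fun x => ¬ D x) {f : ℕ → α} (hf : Computable f) (hI : ∀ x, I (f x))
    (hQ : ∀ x, Q (f x) ↔ ¬ D x) : ¬ SemiDecidableProblem I Q := by
  rintro ⟨R, hR, h⟩
  have hRf : REPred fun x => R (f x) := Partrec.comp hR hf
  exact hD (REPred.of_eq hRf fun x => (h _ (hI x)).trans (hQ x))

lemma Language.isRegular_zero {α : Type} : (0 : Language α).IsRegular :=
  ⟨Unit, inferInstance, ⟨fun _ _ => (), (), ∅⟩, rfl⟩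

lemma Language.isContextFree_zero {α : Type} : (0 : Language α).IsContextFree :=
  ⟨⟨Unit, (), ∅⟩, ContextFreeGrammar.language_eq_zero_of_forall_input_ne_initial (by simp)⟩

open QueueMachine in
theorem mainTheorem5 (k : ℕ) (hk : 2 ≤ k) (t : HeadType) :
    -- emptiness
    ¬ SemiDecidableFor k t (fun _ L => ∀ w, w ∉ L) ∧
    -- finiteness
    ¬ SemiDecidableFor k t (fun n L => Set.Finite (L : Set (List (Fin n)))) ∧
    -- infiniteness
    ¬ SemiDecidableFor k t (fun n L => Set.Infinite (L : Set (List (Fin n)))) ∧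
    -- universality
    ¬ SemiDecidableFor k t (fun _ L => ∀ w, w ∈ L) ∧
    -- inclusion
    ¬ SemiDecidableForPairs k t (fun _ L₁ L₂ => ∀ w, w ∈ L₁ → w ∈ L₂) ∧
    -- equivalence
    ¬ SemiDecidableForPairs k t (fun _ L₁ L₂ => L₁ = L₂) ∧
    -- regularity
    ¬ SemiDecidableFor k t (fun _ L => L.IsRegular) ∧
    -- context-freedom
    ¬ SemiDecidableFor k t (fun _ L => L.IsContextFree) := by
  obtain ⟨n, m, δ, b, e, g, q₀, W, D, hW, hD, hc, hstuck, hyes, hno⟩ := exists_universal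
  let i₀ : Fin k := ⟨0, by omega⟩
  let i₁ : Fin k := ⟨1, by omega⟩
  have hi : i₀ ≠ i₁ := fun h => by simpa [i₀, i₁] using congrArg Fin.val h
  let mark : List ℕ := [stateCode ([b, e], g)]
  let marked : ℕ → MHFACode k := fun x => toCode δ i₀ i₁ (W x) q₀ mark
  let unmarked : ℕ → MHFACode k := fun x => toCode δ i₀ i₁ (W x) q₀
    ((List.range (stateBound (pendings δ (W x) q₀) + 1)).filter fun s => s ∉ mark)
  -- Requiring a pending letter makes acceptance coincide with the end of the tape; excluding `g`
  -- cuts the language off when the counter starts.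
  let writing : ℕ → MHFACode k := fun x => toCode δ i₀ i₁ (W x) q₀
    (((pendings δ (W x) q₀).filter fun p => p.1 ≠ [] ∧ p.2 ≠ g).map stateCode)
  let nothing : ℕ → MHFACode k := fun x => toCode δ i₀ i₁ (W x) q₀ []
  have hmarked : ∀ x, (marked x).lang n = histories δ (W x) q₀ {([b, e], g)} := fun x =>
    toCode_lang hi (hstuck x) (by simp) (by simp [mark, stateCode])
      (by simp [mark, stateCode_injective.eq_iff])
  have hunmarked : ∀ x v, v ∈ (unmarked x).lang n ↔ v ∉ (marked x).lang n := fun x v =>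
    mem_toCode_lang_compl v
  have hwriting : ∀ x, (writing x).lang n = histories δ (W x) q₀ {p | p.1 ≠ [] ∧ p.2 ≠ g} :=
    fun x => toCode_lang hi (hstuck x) (fun p hp => hp.1) (by simp [stateCode]) fun p hp => by
      rw [List.mem_map_of_injective stateCode_injective, List.mem_filter]
      simp [hp]
  have hnothing : ∀ x, (nothing x).lang n = 0 := fun x => by
    refine (toCode_lang (T := ∅) hi (hstuck x) (by simp) (by simp) (by simp)).trans ?_
    exact Set.eq_empty_of_forall_notMem fun v ⟨_, h, _⟩ => h
  have hgaps : ∀ x, D x → ((marked x).lang n).HasGaps := fun x hx => by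
    obtain ⟨i, r, hr⟩ := hyes x hx
    rw [hmarked]
    exact hc.hasGaps hr
  have hzero : ∀ x, ¬ D x → (marked x).lang n = 0 := fun x hx => by
    rw [hmarked]
    refine Set.eq_empty_of_forall_notMem ?_
    rintro v ⟨i, hi, -⟩
    exact hno x hx i (congrArg Prod.snd hi)
  have hne : ∀ x, D x → ∃ v, v ∈ (marked x).lang n := fun x hx =>
    let ⟨v, hv, _⟩ := hgaps x hx 0
    ⟨v, hv⟩
  have pmarked : Primrec marked := (primrec_toCode δ i₀ i₁ q₀ (.const _)).comp hW
  have pnothing : Primrec nothing := (primrec_toCode δ i₀ i₁ q₀ (.const _)).comp hW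
  have punmarked : Primrec unmarked := by
    refine (primrec_toCode δ i₀ i₁ q₀ ((Primrec.listFilter ?_).comp (Primrec.list_range.comp
      (Primrec.succ.comp (primrec_stateBound.comp (primrec_pendings δ q₀)))))).comp hW
    exact (Primrec.eq.comp .id (.const (stateCode ([b, e], g)))).not.of_eq fun s => by simp [mark]
  have pwriting : Primrec writing := by
    refine (primrec_toCode δ i₀ i₁ q₀ (Primrec.list_map ((Primrec.listFilter ?_).comp
      (primrec_pendings δ q₀)) (primrec_stateCode.comp .snd).to₂)).comp hW
    exact ((Primrec.eq.comp .fst (.const [])).not).and ((Primrec.eq.comp .snd (.const g)).not)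
  have type : ∀ (c : MHFACode k), (∃ x F, c = toCode δ i₀ i₁ (W x) q₀ F) →
      (c.toMHFA n).HasType t := by
    rintro _ ⟨x, F, rfl⟩
    exact toMHFA_hasType t
  have single : ∀ {Q : ∀ n : ℕ, Language (Fin n) → Prop} (f : ℕ → MHFACode k), Primrec f →
      (∀ x, ∃ y F, f x = toCode δ i₀ i₁ (W y) q₀ F) → (∀ x, Q n ((f x).lang n) ↔ ¬ D x) →
      ¬ SemiDecidableFor k t Q := fun f hf hx hQ =>
    not_semiDecidableProblem hD (f := fun x => (n, f x)) (Primrec.pair (.const n) hf).to_comp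
      (fun x => type _ (hx x)) hQ
  have pairs : ∀ {Q : ∀ n : ℕ, Language (Fin n) → Language (Fin n) → Prop},
      (∀ x, Q n ((marked x).lang n) ((nothing x).lang n) ↔ ¬ D x) →
      ¬ SemiDecidableForPairs k t Q := fun hQ =>
    not_semiDecidableProblem hD (f := fun x => (n, marked x, nothing x))
      (Primrec.pair (.const n) (.pair pmarked pnothing)).to_comp
      (fun x => ⟨type _ ⟨x, _, rfl⟩, type _ ⟨x, _, rfl⟩⟩) hQ
  refine ⟨single marked pmarked (fun x => ⟨x, _, rfl⟩) fun x => ⟨fun h hx => ?_, fun hx => ?_⟩,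
    single marked pmarked (fun x => ⟨x, _, rfl⟩) fun x => ⟨fun h hx => ?_, fun hx => ?_⟩,
    single writing pwriting (fun x => ⟨x, _, rfl⟩) fun x => ⟨fun h hx => ?_, fun hx => ?_⟩,
    single unmarked punmarked (fun x => ⟨x, _, rfl⟩) fun x => ⟨fun h hx => ?_, fun hx => ?_⟩,
    pairs fun x => ⟨fun h hx => ?_, fun hx => ?_⟩, pairs fun x => ⟨fun h hx => ?_, fun hx => ?_⟩,
    single marked pmarked (fun x => ⟨x, _, rfl⟩) fun x => ⟨fun h hx => ?_, fun hx => ?_⟩,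
    single marked pmarked (fun x => ⟨x, _, rfl⟩) fun x => ⟨fun h hx => ?_, fun hx => ?_⟩⟩
  · obtain ⟨v, hv⟩ := hne x hx
    exact h v hv
  · rw [hzero x hx]
    exact Language.notMem_zero
  · exact (hgaps x hx).infinite h
  · rw [hzero x hx]
    exact Set.finite_empty
  · obtain ⟨i, r, hr⟩ := hyes x hx
    rw [hwriting] at h
    refine h (histories_finite (g := g) (i := i) (fun p hp => hp.2) hc.stay (by rw [hr]))
  · rw [hwriting]
    exact histories_infinite (hstuck x) (hno x hx)
  · obtain ⟨v, hv⟩ := hne x hx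
    exact (hunmarked x v).1 (h v) hv
  · intro v
    rw [hunmarked, hzero x hx]
    exact Language.notMem_zero v
  · obtain ⟨v, hv⟩ := hne x hx
    exact Language.notMem_zero v (hnothing x ▸ h v hv)
  · rw [hzero x hx]
    exact fun v hv => (Language.notMem_zero v hv).elim
  · obtain ⟨v, hv⟩ := hne x hx
    rw [h, hnothing] at hv
    exact Language.notMem_zero v hv
  · rw [hzero x hx, hnothing]
  · exact (hgaps x hx).not_isRegular h
  · rw [hzero x hx]
    exact Language.isRegular_zero
  · exact (hgaps x hx).not_isContextFree h
  · rw [hzero x hx]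
    exact Language.isContextFree_zero
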